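/- Let $X_1,X_2,\dots$ be i.i.d. random variables with values in $[0,\infty)$ and continuous distribution function $F$. Assume that $F$ has on $[0,\infty)$ (one-sided at $0$) first and second derivatives $f=F'$ and $f'=F''$, both continuous and bounded on $[0,\infty)$. Let $F_n(x)=\frac1n\sum_{i=1}^n\mathbb{I}(X_i\le x)$ be the empirical distribution function and, for $m,n\in\mathbb{N}$ with $m,n\ge 1$ and $x\ge 0$, let $$\hat F_{m,n}(x)=\sum_{k=0}^\infty F_n\!\left(\tfrac km\right)e^{-mx}\frac{(mx)^k}{k!}$$ be the Szasz estimator of $F$. Fix $a>0$ and put $$\mathrm{MISE}[\hat F_{m,n}]=\mathbb{E}\left[\int_0^\infty\big(\hat F_{m,n}(x)-F(x)\big)^2e^{-ax}f(x)\,dx\right],$$ where the integral and the expectation exist. Let $\sigma^2(x)=F(x)(1-F(x))$, $V(x)=f(x)\left[\frac{x}{\pi}\right]^{1/2}$ and $b(x)=\frac{xf'(x)}{2}$. Then the integrals $$C_1=\int_0^\infty\sigma^2(x)e^{-ax}f(x)\,dx,\quad C_2=\int_0^\infty V(x)e^{-ax}f(x)\,dx,\quad C_3=\int_0^\infty b(x)^2e^{-ax}f(x)\,dx$$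 exist and are finite, and, as $m,n\to\infty$ (jointly, with no relation between $m$ and $n$ imposed), $$\mathrm{MISE}[\hat F_{m,n}]=n^{-1}C_1-m^{-1/2}n^{-1}C_2+m^{-2}C_3+o(m^{-1/2}n^{-1})+o(m^{-2}).$$ -/

import Mathlib

open MeasureTheory ProbabilityTheory Filter Topology Asymptotics

namespace Szasz

noncomputable section

/-- The Poisson weight `V_{k,m}(x) = e^{-mx} (mx)^k / k!`. -/
def weight (k m : ℕ) (x : ℝ) : ℝ :=
  Real.exp (-((m : ℝ) * x)) * ((m : ℝ) * x) ^ k / (k.factorial : ℝ)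

/-- The Szasz-Mirakyan operator `S_m(u; x) = ∑_{k ≥ 0} u(k/m) V_{k,m}(x)`. -/
def operator (m : ℕ) (u : ℝ → ℝ) (x : ℝ) : ℝ :=
  ∑' k : ℕ, u ((k : ℝ) / (m : ℝ)) * weight k m x

/-- The series defining the Szasz-Mirakyan operator of a bounded function converges. -/
theorem summable_operator (m : ℕ) (u : ℝ → ℝ) (x B : ℝ) (hu : ∀ t, |u t| ≤ B) :
    Summable fun k : ℕ => u ((k : ℝ) / (m : ℝ)) * weight k m x := by
  have h : Summable fun k : ℕ => |((m : ℝ) * x) ^ k / (k.factorial : ℝ)| :=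
    (Real.summable_pow_div_factorial ((m : ℝ) * x)).abs
  refine Summable.of_norm_bounded (h.mul_left (B * Real.exp (-((m : ℝ) * x)))) fun k => ?_
  rw [Real.norm_eq_abs, abs_mul, weight, mul_div_assoc, abs_mul, Real.abs_exp, mul_assoc]
  exact mul_le_mul_of_nonneg_right (hu _) (by positivity)

/-- The empirical distribution function `F_n(x) = n⁻¹ ∑_{i < n} 𝟙(xᵢ ≤ x)` of the first `n` terms
of the data `d`. -/
def empiricalCdf (d : ℕ → ℝ) (n : ℕ) (x : ℝ) : ℝ :=
  (n : ℝ)⁻¹ * ∑ i ∈ Finset.range n, (Set.Iic x).indicator (fun _ => (1 : ℝ)) (d i)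

/-- The Szasz estimator: the Szasz-Mirakyan operator applied to the empirical distribution
function. -/
def estimator (d : ℕ → ℝ) (m n : ℕ) (x : ℝ) : ℝ :=
  operator m (empiricalCdf d n) x

/-- The weighted squared error `(F̂_{m,n}(x) - F(x))² e^{-ax} f(x)` at `x`, for the data `d`. -/
def weightedSqError (F f : ℝ → ℝ) (a : ℝ) (d : ℕ → ℝ) (m n : ℕ) (x : ℝ) : ℝ :=
  (estimator d m n x - F x) ^ 2 * (Real.exp (-(a * x)) * f x)

/-- The weighted integrated squared error over `(0, ∞)`, for the data `d`. -/
def ise (F f : ℝ → ℝ) (a : ℝ) (d : ℕ → ℝ) (m n : ℕ) : ℝ :=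
  ∫ x in Set.Ioi (0 : ℝ), weightedSqError F f a d m n x

/-- The mean-integrated squared error of the Szasz estimator, with weight `e^{-ax} f(x)`, for the
sample `X 0, …, X (n - 1)`. -/
def mise {Ω : Type*} [MeasurableSpace Ω] (P : Measure Ω) (X : ℕ → Ω → ℝ) (F f : ℝ → ℝ) (a : ℝ)
    (m n : ℕ) : ℝ :=
  ∫ ω, ise F f a (fun i => X i ω) m n ∂P

/-- `σ²(x) = F(x) (1 - F(x))`. -/
def sigmaSq (F : ℝ → ℝ) (x : ℝ) : ℝ := F x * (1 - F x)

/-- `V(x) = f(x) (x / π)^{1/2}`. -/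
def varTerm (f : ℝ → ℝ) (x : ℝ) : ℝ := f x * Real.sqrt (x / Real.pi)

/-- `b(x) = x f'(x) / 2`. -/
def biasTerm (f' : ℝ → ℝ) (x : ℝ) : ℝ := x * f' x / 2

/-- The integrand `h(x) e^{-ax} f(x)`. -/
def weighted (f : ℝ → ℝ) (a : ℝ) (h : ℝ → ℝ) (x : ℝ) : ℝ :=
  h x * (Real.exp (-(a * x)) * f x)

/-- `C₁ = ∫₀^∞ σ²(x) e^{-ax} f(x) dx`. -/
def C₁ (F f : ℝ → ℝ) (a : ℝ) : ℝ :=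
  ∫ x in Set.Ioi (0 : ℝ), weighted f a (sigmaSq F) x

/-- `C₂ = ∫₀^∞ V(x) e^{-ax} f(x) dx`. -/
def C₂ (f : ℝ → ℝ) (a : ℝ) : ℝ :=
  ∫ x in Set.Ioi (0 : ℝ), weighted f a (varTerm f) x

/-- `C₃ = ∫₀^∞ b(x)² e^{-ax} f(x) dx`. -/
def C₃ (f f' : ℝ → ℝ) (a : ℝ) : ℝ :=
  ∫ x in Set.Ioi (0 : ℝ), weighted f a (fun y => biasTerm f' y ^ 2) x

end

end Szasz

namespace Szasz

open scoped NNReal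

/-! The weights are Poisson: with `K` of law Poisson(`m x`), the operator is `S_m u(x) = E u(K/m)`.
The estimator is therefore the average of `n` i.i.d. variables `P(X_i ≤ K/m | X_i)`, with mean `S_m
F(x)` and second moment `E F(min(K, L)/m)`, where `L` is an independent copy of `K`. Bias-variance
and Fubini give an exact formula for the MISE (`mise_eq_integral`), and only the two Poisson
expectations need asymptotics.

Bias: second-order Taylor expansion, with `Var(K/m) = x/m`, gives `m (S_m F - F) → x f'/2`
(`tendsto_mul_operator_sub`).

Variance: since `min(K, L) = (K + L - |K - L|)/2`, the second moment is `F - f E|K - L|/(2m) +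
O(x/m)` (`abs_secondMoment_sub_le`). The `m^{-1/2}` term thus reduces to `E|K - L|/√m → 2√(x/π)`,
the absolute mean of a centred Gaussian of variance `2x`. It is proved by writing `|y|` as a
multiple of `∫ (1 - cos ty)/t² dt`, so that convergence of characteristic functions and dominated
convergence suffice (`tendsto_integral_abs_sub_poissonMeasure`).

The rescaled errors are bounded by a multiple of `1 + x²` uniformly in `m`, so dominated convergence
against `e^{-ax} f(x)` integrates both limits. The quantities that converge depend on `m` alone,
hence no relation between `m` and `n` is needed. -/

/-! ### Poisson moments up to order four. -/

/-- From `k r^k / k! = r · r^(k-1) / (k-1)!`. This shift yields each moment from the lower ones. -/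
theorem integral_natCast_mul_poissonMeasure (r : ℝ≥0) (f : ℕ → ℝ) :
    ∫ k, (k : ℝ) * f k ∂poissonMeasure r = r * ∫ k, f (k + 1) ∂poissonMeasure r := by
  rw [integral_poissonMeasure, integral_poissonMeasure, ← tsum_mul_left,
    ← (add_left_injective 1).tsum_eq (β := ℕ)]
  · refine tsum_congr fun k => ?_
    have : ((k : ℝ) + 1) ≠ 0 := by positivity
    simp only [smul_eq_mul, Nat.factorial_succ, pow_succ, Nat.cast_mul, Nat.cast_add, Nat.cast_one]
    have h : ((k.factorial : ℕ) : ℝ) ≠ 0 := by positivity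
    field_simp
  · intro k hk
    cases k with
    | zero => simp at hk
    | succ k => exact ⟨k, rfl⟩

theorem integrable_pow_poissonMeasure (r : ℝ≥0) (j : ℕ) :
    Integrable (fun k : ℕ => (k : ℝ) ^ j) (poissonMeasure r) := by
  rw [integrable_poissonMeasure_iff]
  -- Since `k^j ≤ j! e^k`, the moment series is dominated by an exponential series with parameter `r
  -- e`.
  have h := ((Real.summable_pow_div_factorial ((r : ℝ) * Real.exp 1)).mul_left
    (Real.exp (-r) * j.factorial))
  refine Summable.of_nonneg_of_le (fun k => by positivity) (fun k => ?_) h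
  have h1 := Real.pow_div_factorial_le_exp (k : ℝ) (by positivity) j
  rw [div_le_iff₀ (by positivity)] at h1
  rw [Real.norm_of_nonneg (by positivity), mul_pow, ← Real.exp_nat_mul, mul_one]
  calc _ ≤ Real.exp (-r) * r ^ k / k.factorial * (Real.exp k * j.factorial) := by gcongr
    _ = _ := by ring

theorem integral_natCast_poissonMeasure (r : ℝ≥0) :
    ∫ k, (k : ℝ) ∂poissonMeasure r = r := by
  simpa using integral_natCast_mul_poissonMeasure r (fun _ => 1)

theorem integrable_natCast_poissonMeasure (r : ℝ≥0) :
    Integrable (fun k : ℕ => (k : ℝ)) (poissonMeasure r) := by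
  simpa using integrable_pow_poissonMeasure r 1

theorem integral_sq_poissonMeasure (r : ℝ≥0) :
    ∫ k, (k : ℝ) ^ 2 ∂poissonMeasure r = r ^ 2 + r := by
  have h := integral_natCast_mul_poissonMeasure r (fun k => (k : ℝ))
  simp only [Nat.cast_add, Nat.cast_one] at h
  rw [integral_add (integrable_natCast_poissonMeasure r) (integrable_const _),
    integral_natCast_poissonMeasure] at h
  simp only [pow_two]
  rw [h]
  simp
  ring

theorem integral_cube_poissonMeasure (r : ℝ≥0) :
    ∫ k, (k : ℝ) ^ 3 ∂poissonMeasure r = r ^ 3 + 3 * r ^ 2 + r := by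
  have h := integral_natCast_mul_poissonMeasure r (fun k => (k : ℝ) ^ 2)
  have e : ∀ k : ℕ, ((k + 1 : ℕ) : ℝ) ^ 2 = (k : ℝ) ^ 2 + (2 * k + 1) := fun k => by
    push_cast; ring
  have i1 := integrable_natCast_poissonMeasure r
  have i2 := integrable_pow_poissonMeasure r 2
  simp only [e] at h
  rw [integral_add (by fun_prop) (by fun_prop), integral_add (by fun_prop) (by fun_prop),
    integral_const_mul, integral_natCast_poissonMeasure, integral_sq_poissonMeasure] at h
  simp only [pow_succ' _ 2]
  rw [h]
  simp
  ring

theorem integral_fourth_poissonMeasure (r : ℝ≥0) :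
    ∫ k, (k : ℝ) ^ 4 ∂poissonMeasure r = r ^ 4 + 6 * r ^ 3 + 7 * r ^ 2 + r := by
  have h := integral_natCast_mul_poissonMeasure r (fun k => (k : ℝ) ^ 3)
  have e : ∀ k : ℕ, ((k + 1 : ℕ) : ℝ) ^ 3 = (k : ℝ) ^ 3 + (3 * (k : ℝ) ^ 2 + (3 * k + 1)) :=
    fun k => by push_cast; ring
  have i1 := integrable_natCast_poissonMeasure r
  have i2 := integrable_pow_poissonMeasure r 2
  have i3 := integrable_pow_poissonMeasure r 3
  simp only [e] at h
  rw [integral_add (by fun_prop) (by fun_prop), integral_add (by fun_prop) (by fun_prop),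
    integral_add (by fun_prop) (by fun_prop), integral_const_mul, integral_const_mul,
    integral_natCast_poissonMeasure, integral_sq_poissonMeasure,
    integral_cube_poissonMeasure] at h
  simp only [pow_succ' _ 3]
  rw [h]
  simp
  ring

theorem integrable_sub_pow_poissonMeasure (r : ℝ≥0) (c : ℝ) (j : ℕ) :
    Integrable (fun k : ℕ => ((k : ℝ) - c) ^ j) (poissonMeasure r) := by
  simp only [sub_eq_add_neg, add_pow]
  exact integrable_finsetSum _ fun i _ =>
    (((integrable_pow_poissonMeasure r i).mul_const _).mul_const _)

theorem integral_sub_sq_poissonMeasure (r : ℝ≥0) :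
    ∫ k, ((k : ℝ) - r) ^ 2 ∂poissonMeasure r = r := by
  have i1 := integrable_natCast_poissonMeasure r
  have i2 := integrable_pow_poissonMeasure r 2
  have e : ∀ k : ℕ, ((k : ℝ) - r) ^ 2 = (k : ℝ) ^ 2 + (-2 * r * k + r ^ 2) := fun k => by ring
  simp only [e]
  rw [integral_add (by fun_prop) (by fun_prop), integral_add (by fun_prop) (by fun_prop),
    integral_const_mul,
    integral_natCast_poissonMeasure, integral_sq_poissonMeasure]
  simp
  ring

theorem integral_sub_fourth_poissonMeasure (r : ℝ≥0) :
    ∫ k, ((k : ℝ) - r) ^ 4 ∂poissonMeasure r = 3 * r ^ 2 + r := by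
  have i1 := integrable_natCast_poissonMeasure r
  have i2 := integrable_pow_poissonMeasure r 2
  have i3 := integrable_pow_poissonMeasure r 3
  have i4 := integrable_pow_poissonMeasure r 4
  have e : ∀ k : ℕ, ((k : ℝ) - r) ^ 4 = (k : ℝ) ^ 4 + (-4 * r * (k : ℝ) ^ 3 +
      (6 * r ^ 2 * (k : ℝ) ^ 2 + (-4 * r ^ 3 * k + r ^ 4))) := fun k => by ring
  simp only [e]
  rw [integral_add (by fun_prop) (by fun_prop), integral_add (by fun_prop) (by fun_prop),
    integral_add (by fun_prop) (by fun_prop), integral_add (by fun_prop) (by fun_prop),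
      integral_const_mul, integral_const_mul,
    integral_const_mul, integral_natCast_poissonMeasure, integral_sq_poissonMeasure,
    integral_cube_poissonMeasure, integral_fourth_poissonMeasure]
  simp
  ring

/-! ### Absolute first moments from cosine transforms. -/

/-- The characteristic function of the difference of two independent Poisson variables. -/
theorem integral_cos_sub_poissonMeasure (r : ℝ≥0) (s : ℝ) :
    ∫ p : ℕ × ℕ, Real.cos (s * ((p.1 : ℝ) - p.2)) ∂(poissonMeasure r).prod (poissonMeasure r)
      = Real.exp (-(2 * r * (1 - Real.cos s))) := by
  have hb : ∀ g : ℕ → ℝ, (∀ k, |g k| ≤ 1) → Integrable g (poissonMeasure r) := fun g hg =>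
    Integrable.of_bound (C := 1) .of_discrete (ae_of_all _ hg)
  have hc := hb (fun k => Real.cos (s * k)) fun k => Real.abs_cos_le_one _
  have hs := hb (fun k => Real.sin (s * k)) fun k => Real.abs_sin_le_one _
  have e : ∀ p : ℕ × ℕ, Real.cos (s * ((p.1 : ℝ) - p.2)) =
      Real.cos (s * p.1) * Real.cos (s * p.2) + Real.sin (s * p.1) * Real.sin (s * p.2) :=
    fun p => by rw [mul_sub, Real.cos_sub]
  simp only [e]
  rw [integral_add (hc.mul_prod hc) (hs.mul_prod hs),
    integral_prod_mul (μ := poissonMeasure r) (ν := poissonMeasure r)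
      (fun k : ℕ => Real.cos (s * k)) (fun k : ℕ => Real.cos (s * k)),
    integral_prod_mul (μ := poissonMeasure r) (ν := poissonMeasure r)
      (fun k : ℕ => Real.sin (s * k)) (fun k : ℕ => Real.sin (s * k))]
  have h := charFun_map_cast_poissonMeasure r s
  rw [charFun_apply_real, integral_map .of_discrete (by fun_prop)] at h
  have hz : ∀ k : ℕ, Complex.exp ((s : ℂ) * ((k : ℝ) : ℂ) * Complex.I) =
      (Real.cos (s * k) : ℂ) + (Real.sin (s * k) : ℂ) * Complex.I := fun k => by
    rw [← Complex.ofReal_mul, Complex.exp_mul_I, ← Complex.ofReal_cos, ← Complex.ofReal_sin]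
  simp only [hz] at h
  rw [integral_add hc.ofReal (hs.ofReal.mul_const _), integral_mul_const, integral_complex_ofReal,
    integral_complex_ofReal] at h
  -- By the addition formula the goal is `(E cos sK)² + (E sin sK)²`, the squared modulus of the
  -- characteristic function of one variable.
  have h2 := congrArg Complex.normSq h
  rw [Complex.normSq_add_mul_I] at h2
  rw [← pow_two, ← pow_two]
  refine h2.trans ?_
  rw [Complex.normSq_eq_norm_sq, Complex.norm_exp, ← Real.exp_nat_mul]
  congr 1
  rw [mul_comm (s : ℂ)]
  simp [Complex.exp_re]
  ring

/-- The constant `∫ (1 - cos t) / t² dt`. -/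
noncomputable def cosConst : ℝ := ∫ t : ℝ, (1 - Real.cos t) / t ^ 2

theorem one_sub_cos_mul_div_sq_nonneg (y t : ℝ) : 0 ≤ (1 - Real.cos (t * y)) / t ^ 2 :=
  div_nonneg (by linarith [Real.cos_le_one (t * y)]) (by positivity)

/-- `1 - cos u ≤ u²/2` controls small `t` and `1 - cos u ≤ 2` large `t`; at `t = 0` the quotient is
`0` by convention. -/
theorem one_sub_cos_mul_div_sq_le (y t : ℝ) :
    (1 - Real.cos (t * y)) / t ^ 2 ≤ (2 + y ^ 2) * (1 + t ^ 2)⁻¹ := by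
  rcases eq_or_ne t 0 with rfl | ht
  · simp; positivity
  rw [← div_eq_mul_inv, div_le_div_iff₀ (by positivity) (by positivity)]
  have h1 := Real.one_sub_sq_div_two_le_cos (x := t * y)
  have h2 := Real.neg_one_le_cos (t * y)
  nlinarith [mul_nonneg (sq_nonneg t) (by linarith : 0 ≤ 1 + Real.cos (t * y)),
    mul_nonneg (sq_nonneg t) (sq_nonneg y)]

theorem integrable_one_sub_cos_div_sq : Integrable fun t : ℝ => (1 - Real.cos t) / t ^ 2 := by
  refine (integrable_inv_one_add_sq.const_mul 3).mono' (Measurable.aestronglyMeasurable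
    (by fun_prop))
    (ae_of_all _ fun t => ?_)
  have h := one_sub_cos_mul_div_sq_nonneg 1 t
  have h' := one_sub_cos_mul_div_sq_le 1 t
  rw [mul_one] at h h'
  rw [Real.norm_of_nonneg h]
  linarith

/-- Positivity is all that is needed: the constant occurs on both sides of the final limit and is
cancelled, so its value is never computed. -/
theorem cosConst_pos : 0 < cosConst := by
  have hn : ∀ t : ℝ, 0 ≤ (1 - Real.cos t) / t ^ 2 := fun t => by
    simpa using one_sub_cos_mul_div_sq_nonneg 1 t
  rw [cosConst, integral_pos_iff_support_of_nonneg hn integrable_one_sub_cos_div_sq]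
  refine lt_of_lt_of_le ?_ (measure_mono (s := Set.Ioo 0 1) fun t ht => ?_)
  · simp
  · have : Real.cos t < 1 := by
      have := Real.cos_lt_cos_of_nonneg_of_le_pi le_rfl
        (by linarith [ht.2, Real.pi_gt_three] : t ≤ Real.pi) ht.1
      simpa using this
    exact (div_pos (by linarith) (by have := ht.1; positivity)).ne'

/-- Substituting `t y` for `t` produces the factor `y² / |y|`. -/
theorem integral_one_sub_cos_mul_div_sq (y : ℝ) :
    ∫ t : ℝ, (1 - Real.cos (t * y)) / t ^ 2 = |y| * cosConst := by
  rcases eq_or_ne y 0 with rfl | hy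
  · simp
  have e : ∀ t : ℝ, (1 - Real.cos (t * y)) / t ^ 2 =
      y ^ 2 * ((1 - Real.cos (t * y)) / (t * y) ^ 2) := fun t => by
    rw [mul_pow]
    rcases eq_or_ne t 0 with rfl | ht
    · simp
    field_simp
  simp only [e]
  rw [integral_const_mul, Measure.integral_comp_mul_right (fun t => (1 - Real.cos t) / t ^ 2) y,
    ← cosConst, smul_eq_mul, abs_inv, ← sq_abs]
  have : |y| ≠ 0 := by simpa
  field_simp

/-- The absolute first moment as an integral of the characteristic function. -/
theorem cosConst_mul_integral_abs {Ω : Type*} [MeasurableSpace Ω] (μ : Measure Ω)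
    [IsProbabilityMeasure μ] (Z : Ω → ℝ) (hZ : Measurable Z) (hZ2 : Integrable
    (fun ω => Z ω ^ 2) μ) :
    (∫ ω, |Z ω| ∂μ) * cosConst = ∫ t : ℝ, (1 - ∫ ω, Real.cos (t * Z ω) ∂μ) / t ^ 2 := by
  rw [← integral_mul_const]
  simp only [← integral_one_sub_cos_mul_div_sq]
  rw [integral_integral_swap]
  · refine integral_congr_ae (ae_of_all _ fun t => ?_)
    simp only
    have hc : Integrable (fun ω => Real.cos (t * Z ω)) μ :=
      Integrable.of_bound (C := 1) (by fun_prop) (ae_of_all _ fun ω => Real.abs_cos_le_one _)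
    rw [integral_div, integral_sub (integrable_const _) hc]
    simp
  · have h : Integrable (fun p : Ω × ℝ => (2 + Z p.1 ^ 2) * (1 + p.2 ^ 2)⁻¹) (μ.prod volume) :=
      Integrable.mul_prod ((integrable_const (2 : ℝ)).add hZ2) integrable_inv_one_add_sq
    refine h.mono' ?_ (ae_of_all _ fun p => ?_)
    · refine Measurable.aestronglyMeasurable ?_
      simp only [Function.uncurry_def]
      fun_prop
    · simp only [Function.uncurry_def]
      rw [Real.norm_of_nonneg (one_sub_cos_mul_div_sq_nonneg _ _)]
      exact one_sub_cos_mul_div_sq_le _ _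

/-- Supplies the dominating function in `t` for a family of variables with bounded second moments.
-/
theorem one_sub_integral_cos_bounds {Ω : Type*} [MeasurableSpace Ω] (μ : Measure Ω)
    [IsProbabilityMeasure μ] (Z : Ω → ℝ) (hZ : Measurable Z) (hZ2 : Integrable (fun ω => Z ω ^ 2) μ)
    (t : ℝ) :
    |(1 - ∫ ω, Real.cos (t * Z ω) ∂μ) / t ^ 2| ≤ (2 + ∫ ω, Z ω ^ 2 ∂μ) * (1 + t ^ 2)⁻¹ := by
  have hc : Integrable (fun ω => Real.cos (t * Z ω)) μ :=
    Integrable.of_bound (C := 1) (by fun_prop) (ae_of_all _ fun ω => Real.abs_cos_le_one _)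
  have e : (1 - ∫ ω, Real.cos (t * Z ω) ∂μ) / t ^ 2 =
      ∫ ω, (1 - Real.cos (t * Z ω)) / t ^ 2 ∂μ := by
    rw [integral_div, integral_sub (integrable_const _) hc]
    simp
  have e' : (2 + ∫ ω, Z ω ^ 2 ∂μ) * (1 + t ^ 2)⁻¹ = ∫ ω, (2 + Z ω ^ 2) * (1 + t ^ 2)⁻¹ ∂μ := by
    rw [integral_mul_const, integral_add (integrable_const _) hZ2]
    simp
  rw [e, e', abs_of_nonneg (integral_nonneg fun ω => one_sub_cos_mul_div_sq_nonneg _ _)]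
  exact integral_mono ((((integrable_const _).sub hc)).div_const _)
    (((integrable_const _).add hZ2).mul_const _) fun ω => one_sub_cos_mul_div_sq_le _ _

theorem integral_abs_gaussianReal (v : ℝ≥0) (hv : v ≠ 0) :
    ∫ y, |y| ∂gaussianReal 0 v = Real.sqrt (2 * v / Real.pi) := by
  rw [integral_gaussianReal_eq_integral_smul hv]
  have hv' : (0 : ℝ) < v := by positivity
  have e : ∀ y : ℝ, gaussianPDFReal 0 v y • |y| =
      (fun y : ℝ => (Real.sqrt (2 * Real.pi * v))⁻¹ * (y * Real.exp (-(2 * (v :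
        ℝ))⁻¹ * y ^ 2))) |y| :=
    fun y => by
      simp only [gaussianPDFReal, sq_abs, smul_eq_mul, sub_zero]
      rw [div_eq_inv_mul, mul_neg, neg_mul]
      ring
  simp only [e]
  rw [integral_comp_abs
    (f := fun y : ℝ => (Real.sqrt (2 * Real.pi * v))⁻¹ * (y * Real.exp (-(2 * (v : ℝ))⁻¹ * y ^ 2))),
    integral_const_mul]
  have h := integral_rpow_mul_exp_neg_mul_rpow (p := 2) (q := 1) (b := (2 * (v : ℝ))⁻¹)
    (by norm_num) (by norm_num) (by positivity)
  simp only [Real.rpow_one, Real.rpow_two] at h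
  rw [h]
  have h1 : ((2 * (v : ℝ))⁻¹) ^ (-((1 : ℝ) + 1) / 2) = 2 * v := by
    norm_num [Real.rpow_neg_one]
  rw [h1]
  norm_num
  have a1 : Real.sqrt v ^ 2 = v := Real.sq_sqrt hv'.le
  have a2 : Real.sqrt 2 ^ 2 = 2 := Real.sq_sqrt (by norm_num)
  have p1 : 0 < Real.sqrt v := Real.sqrt_pos.2 hv'
  have p2 : 0 < Real.sqrt 2 := by positivity
  have p3 : 0 < Real.sqrt Real.pi := Real.sqrt_pos.2 Real.pi_pos
  field_simp
  rw [a1, a2]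
  ring


/-! ### Gaussian limit for the difference of two Poisson variables. -/

theorem integrable_sub_sq_prod_poissonMeasure (r : ℝ≥0) :
    Integrable (fun p : ℕ × ℕ => ((p.1 : ℝ) - p.2) ^ 2)
      ((poissonMeasure r).prod (poissonMeasure r)) := by
  have i1 := (integrable_sub_pow_poissonMeasure r 0 2).comp_fst (poissonMeasure r)
  have i2 := (integrable_sub_pow_poissonMeasure r 0 2).comp_snd (poissonMeasure r)
  refine ((i1.add i2).const_mul 2).mono' .of_discrete (ae_of_all _ fun p => ?_)
  rw [Real.norm_of_nonneg (by positivity)]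
  simp only [Pi.add_apply, sub_zero]
  nlinarith [sq_nonneg ((p.1 : ℝ) + p.2)]

theorem integral_sub_sq_prod_poissonMeasure (r : ℝ≥0) :
    ∫ p : ℕ × ℕ, ((p.1 : ℝ) - p.2) ^ 2 ∂(poissonMeasure r).prod (poissonMeasure r) = 2 * r := by
  have i1 := (integrable_sub_pow_poissonMeasure r r 2).comp_fst (poissonMeasure r)
  have i2 := (integrable_sub_pow_poissonMeasure r r 2).comp_snd (poissonMeasure r)
  have j := integrable_sub_pow_poissonMeasure r r 1
  simp only [pow_one] at j
  have j2 := j.mul_prod j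
  have e : ∀ p : ℕ × ℕ, ((p.1 : ℝ) - p.2) ^ 2 = ((p.1 : ℝ) - r) ^ 2 + ((p.2 : ℝ) - r) ^ 2 -
      2 * (((p.1 : ℝ) - r) * ((p.2 : ℝ) - r)) := fun p => by ring
  simp only [e]
  rw [integral_sub (by fun_prop) (by fun_prop), integral_add i1 i2, integral_const_mul,
    integral_prod_mul (μ := poissonMeasure r) (ν := poissonMeasure r)
      (fun k : ℕ => (k : ℝ) - r) (fun k : ℕ => (k : ℝ) - r),
    integral_sub (integrable_natCast_poissonMeasure r) (integrable_const _),
    integral_fun_fst (fun k : ℕ => ((k : ℝ) - r) ^ 2),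
    integral_fun_snd (fun k : ℕ => ((k : ℝ) - r) ^ 2), integral_sub_sq_poissonMeasure,
    integral_natCast_poissonMeasure]
  simp
  ring

/-- As `1 - cos 2u = 2 sin² u`, the expression equals `(t²/2) sinc²(t/(2√m))` for `m > 0`, and
`sinc` is continuous with value `1` at `0`. -/
theorem tendsto_mul_one_sub_cos_div_sqrt (t : ℝ) :
    Tendsto (fun m : ℕ => (m : ℝ) * (1 - Real.cos (t / √m))) atTop (𝓝 (t ^ 2 / 2)) := by
  have hs : Tendsto (fun m : ℕ => √(m : ℝ)) atTop atTop :=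
    Real.tendsto_sqrt_atTop.comp tendsto_natCast_atTop_atTop
  have h0 : Tendsto (fun m : ℕ => t / 2 / √(m : ℝ)) atTop (𝓝 0) :=
    tendsto_const_nhds.div_atTop hs
  have h1 : Tendsto (fun m : ℕ => Real.sinc (t / 2 / √(m : ℝ))) atTop (𝓝 1) := by
    have := (Real.continuous_sinc.tendsto 0).comp h0
    rwa [Real.sinc_zero] at this
  have h2 := (h1.pow 2).const_mul (t ^ 2 / 2)
  rw [one_pow, mul_one] at h2
  refine h2.congr' ?_
  filter_upwards [eventually_gt_atTop 0] with m hm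
  have hm' : (0 : ℝ) < m := by exact_mod_cast hm
  have hq : √(m : ℝ) ^ 2 = m := Real.sq_sqrt hm'.le
  rcases eq_or_ne t 0 with rfl | ht
  · simp
  have hq0 : √(m : ℝ) ≠ 0 := (Real.sqrt_pos.2 hm').ne'
  rw [Real.sinc_of_ne_zero (by positivity),
    show t / √(m : ℝ) = 2 * (t / 2 / √(m : ℝ)) by ring, Real.cos_two_mul, Real.cos_sq']
  field_simp
  rw [hq]
  ring

/-- The scaled mean difference of two independent Poisson variables with parameter `m x`. -/
theorem tendsto_integral_abs_sub_poissonMeasure {x : ℝ} (hx : 0 < x) :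
    Tendsto (fun m : ℕ => ∫ p : ℕ × ℕ, |((p.1 : ℝ) - p.2) / √m|
      ∂(poissonMeasure (m * x).toNNReal).prod (poissonMeasure (m * x).toNNReal)) atTop
      (𝓝 (2 * √(x / Real.pi))) := by
  have hr : ∀ m : ℕ, (((m * x : ℝ).toNNReal : ℝ≥0) : ℝ) = m * x := fun m =>
    Real.coe_toNNReal _ (by positivity)
  have hv : ((2 * x).toNNReal : ℝ) = 2 * x := Real.coe_toNNReal _ (by positivity)
  have hv0 : (2 * x).toNNReal ≠ 0 := by simpa using hx
  -- The limit of the cosine integrals is recognised as that of the Gaussian of variance `2x`, whose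
  -- absolute mean is explicit.
  have hG := cosConst_mul_integral_abs (gaussianReal 0 (2 * x).toNNReal) id measurable_id
    (memLp_id_gaussianReal 2).integrable_sq
  simp only [id] at hG
  rw [integral_abs_gaussianReal _ hv0, hv] at hG
  have hcos : ∀ t : ℝ, ∫ y, Real.cos (t * y) ∂gaussianReal 0 (2 * x).toNNReal =
      Real.exp (-(x * t ^ 2)) := fun t => by
    have h := charFun_gaussianReal (μ := 0) (v := (2 * x).toNNReal) t
    rw [charFun_apply_real] at h
    have h2 := congrArg Complex.re h
    have hi : Integrable (fun y : ℝ => Complex.exp ((t : ℂ) * y * Complex.I))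
        (gaussianReal 0 (2 * x).toNNReal) :=
      Integrable.of_bound (C := 1) (by fun_prop) (ae_of_all _ fun y => by
        rw [← Complex.ofReal_mul, Complex.norm_exp_ofReal_mul_I])
    rw [← RCLike.re_eq_complex_re, ← integral_re hi] at h2
    simp only [← Complex.ofReal_mul, RCLike.re_eq_complex_re, Complex.exp_ofReal_mul_I_re] at h2
    rw [h2, hv, show ((t * 0 : ℝ) : ℂ) * Complex.I - ((2 * x : ℝ) : ℂ) * (t : ℂ) ^ 2 / 2 =
      ((-(x * t ^ 2) : ℝ) : ℂ) by push_cast; ring, Complex.exp_ofReal_re]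
  simp only [hcos] at hG
  have hlim : √(2 * (2 * x) / Real.pi) = 2 * √(x / Real.pi) := by
    rw [show 2 * (2 * x) / Real.pi = 2 ^ 2 * (x / Real.pi) by ring,
      Real.sqrt_mul (by positivity), Real.sqrt_sq (by norm_num)]
  rw [hlim] at hG
  have hsq : ∀ m : ℕ, Integrable (fun p : ℕ × ℕ => (((p.1 : ℝ) - p.2) / √m) ^ 2)
      ((poissonMeasure (m * x).toNNReal).prod (poissonMeasure (m * x).toNNReal)) := fun m => by
    simp only [div_pow]
    exact (integrable_sub_sq_prod_poissonMeasure _).div_const _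
  have hmom : ∀ m : ℕ, ∫ p : ℕ × ℕ, (((p.1 : ℝ) - p.2) / √m) ^ 2
      ∂(poissonMeasure (m * x).toNNReal).prod (poissonMeasure (m * x).toNNReal) ≤ 2 * x :=
    fun m => by
    simp only [div_pow]
    rw [integral_div, integral_sub_sq_prod_poissonMeasure, hr, Real.sq_sqrt (by positivity)]
    rcases Nat.eq_zero_or_pos m with rfl | hm
    · simp; exact hx.le
    · have : (0 : ℝ) < m := by exact_mod_cast hm
      apply le_of_eq
      field_simp
  have hcP : ∀ (m : ℕ) (t : ℝ), ∫ p : ℕ × ℕ, Real.cos (t * (((p.1 : ℝ) - p.2) / √m))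
      ∂(poissonMeasure (m * x).toNNReal).prod (poissonMeasure (m * x).toNNReal) =
      Real.exp (-(2 * x * (m * (1 - Real.cos (t / √m))))) := fun m t => by
    have e : ∀ p : ℕ × ℕ, t * (((p.1 : ℝ) - p.2) / √m) = t / √m * ((p.1 : ℝ) - p.2) :=
      fun p => by ring
    simp only [e]
    rw [integral_cos_sub_poissonMeasure, hr]
    congr 1
    ring
  have key : Tendsto (fun m : ℕ => (∫ p : ℕ × ℕ, |((p.1 : ℝ) - p.2) / √m|
      ∂(poissonMeasure (m * x).toNNReal).prod (poissonMeasure (m * x).toNNReal)) * cosConst) atTop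
      (𝓝 (2 * √(x / Real.pi) * cosConst)) := by
    rw [hG]
    have hZ : ∀ m : ℕ, Measurable fun p : ℕ × ℕ => ((p.1 : ℝ) - p.2) / √m :=
      fun m => .of_discrete
    simp only [fun m => cosConst_mul_integral_abs _ _ (hZ m) (hsq m)]
    refine tendsto_integral_of_dominated_convergence (fun t => (2 + 2 * x) * (1 + t ^ 2)⁻¹) ?_
      (integrable_inv_one_add_sq.const_mul _) ?_ ?_
    · intro m
      simp only [hcP]
      exact Measurable.aestronglyMeasurable (by fun_prop)
    · intro m
      refine ae_of_all _ fun t => (one_sub_integral_cos_bounds _ _ (hZ m) (hsq m) t).trans ?_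
      gcongr
      exact hmom m
    · refine ae_of_all _ fun t => ?_
      simp only [hcP]
      have h := (tendsto_mul_one_sub_cos_div_sqrt t).const_mul (2 * x)
      have h' := (Real.continuous_exp.tendsto _).comp h.neg
      have h2 := (h'.const_sub 1).div_const (t ^ 2)
      rwa [show -(2 * x * (t ^ 2 / 2)) = -(x * t ^ 2) by ring] at h2
  have h := key.div_const cosConst
  simpa only [mul_div_cancel_right₀ _ cosConst_pos.ne'] using h

/-! ### Taylor bounds on the half-line. -/

theorem integrable_fun_add {α : Type*} [MeasurableSpace α] {μ : Measure α} {u v : α → ℝ}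
    (hu : Integrable u μ) (hv : Integrable v μ) : Integrable (fun a => u a + v a) μ :=
  hu.add hv

theorem min_eq_add_sub_abs_div_two (a b : ℝ) : min a b = (a + b - |a - b|) / 2 := by
  rcases le_total a b with h | h
  · rw [min_eq_left h, abs_of_nonpos (by linarith)]; ring
  · rw [min_eq_right h, abs_of_nonneg (by linarith)]; ring

/-- `f` is `B`-Lipschitz, so the remainder has derivative at most `B |y - x|` between `x` and `y`;
the mean value inequality concludes. The sharper `B/2` is not needed. -/
theorem abs_taylor_one_le {F f f' : ℝ → ℝ} {B : ℝ}
    (hf : ∀ x ∈ Set.Ici (0 : ℝ), HasDerivWithinAt F (f x) (Set.Ici 0) x)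
    (hf' : ∀ x ∈ Set.Ici (0 : ℝ), HasDerivWithinAt f (f' x) (Set.Ici 0) x)
    (hB : ∀ x ∈ Set.Ici (0 : ℝ), |f' x| ≤ B) {x y : ℝ} (hx : 0 ≤ x) (hy : 0 ≤ y) :
    |F y - F x - f x * (y - x)| ≤ B * (y - x) ^ 2 := by
  have hB0 : 0 ≤ B := (abs_nonneg _).trans (hB 0 Set.self_mem_Ici)
  have hsub : Set.uIcc x y ⊆ Set.Ici 0 := fun z hz => (le_min hx hy).trans hz.1
  have hg : ∀ z ∈ Set.uIcc x y,
      HasDerivWithinAt (fun z => F z - f x * (z - x)) (f z - f x) (Set.uIcc x y) z := fun z hz => by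
    refine (((hf z (hsub hz)).mono hsub).sub
      ((((hasDerivAt_id z).sub_const x).const_mul (f x)).hasDerivWithinAt)).congr_deriv ?_
    simp
  have hbd : ∀ z ∈ Set.uIcc x y, ‖f z - f x‖ ≤ B * |y - x| := fun z hz => by
    have h := (convex_Ici (0 : ℝ)).norm_image_sub_le_of_norm_hasDerivWithin_le hf' hB hx (hsub hz)
    refine h.trans (mul_le_mul_of_nonneg_left ?_ hB0)
    exact Set.abs_sub_left_of_mem_uIcc hz
  have h := (convex_uIcc x y).norm_image_sub_le_of_norm_hasDerivWithin_le hg hbd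
    Set.left_mem_uIcc Set.right_mem_uIcc
  simp only [Real.norm_eq_abs, sub_self, mul_zero, sub_zero] at h
  rw [mul_assoc, ← pow_two, sq_abs] at h
  rwa [sub_right_comm]

/-- Near `x`, differentiability of `f` at `x` bounds the derivative of the remainder by `ε |y - x|`.
Far away a fourth power absorbs the quadratic bound; it is harmless because the fourth central
moment of `K/m` is `O(m⁻²)`. -/
theorem exists_abs_taylor_two_le {F f f' : ℝ → ℝ} {B : ℝ}
    (hf : ∀ x ∈ Set.Ici (0 : ℝ), HasDerivWithinAt F (f x) (Set.Ici 0) x)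
    (hf' : ∀ x ∈ Set.Ici (0 : ℝ), HasDerivWithinAt f (f' x) (Set.Ici 0) x)
    (hB : ∀ x ∈ Set.Ici (0 : ℝ), |f' x| ≤ B) {x : ℝ} (hx : 0 ≤ x) {ε : ℝ} (hε : 0 < ε) :
    ∃ C : ℝ, ∀ y, 0 ≤ y → |F y - F x - f x * (y - x) - f' x / 2 * (y - x) ^ 2| ≤
      ε * (y - x) ^ 2 + C * (y - x) ^ 4 := by
  have hB0 : 0 ≤ B := (abs_nonneg _).trans (hB 0 Set.self_mem_Ici)
  obtain ⟨δ, hδ, hd⟩ := Metric.eventually_nhds_iff.1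
    (eventually_nhdsWithin_iff.1 ((hasDerivWithinAt_iff_isLittleO.1 (hf' x hx)).def hε))
  -- When `|y - x| ≥ δ`, the remainder is at most `2B (y - x)²`, and `(y - x)² ≤ (y - x)⁴ / δ²`.
  refine ⟨2 * B / δ ^ 2, fun y hy => ?_⟩
  rcases lt_or_ge |y - x| δ with hlt | hge
  · have hsub : Set.uIcc x y ⊆ Set.Ici 0 := fun z hz => (le_min hx hy).trans hz.1
    have hg : ∀ z ∈ Set.uIcc x y,
        HasDerivWithinAt (fun z => F z - f x * (z - x) - f' x / 2 * (z - x) ^ 2)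
          (f z - f x - f' x * (z - x)) (Set.uIcc x y) z := fun z hz => by
      have h1 := (((hasDerivAt_id z).sub_const x).const_mul (f x)).hasDerivWithinAt
        (s := Set.uIcc x y)
      have h2 := ((((hasDerivAt_id z).sub_const x).pow 2).const_mul (f' x / 2)).hasDerivWithinAt
        (s := Set.uIcc x y)
      refine ((((hf z (hsub hz)).mono hsub).sub h1).sub h2).congr_deriv ?_
      simp
      ring
    have hbd : ∀ z ∈ Set.uIcc x y, ‖f z - f x - f' x * (z - x)‖ ≤ ε * |y - x| := fun z hz => by
      have hz' := Set.abs_sub_left_of_mem_uIcc hz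
      have h := hd (y := z) (by rw [Real.dist_eq]; exact hz'.trans_lt hlt) (hsub hz)
      rw [smul_eq_mul, mul_comm (z - x)] at h
      exact h.trans (mul_le_mul_of_nonneg_left hz' hε.le)
    have h := (convex_uIcc x y).norm_image_sub_le_of_norm_hasDerivWithin_le hg hbd
      Set.left_mem_uIcc Set.right_mem_uIcc
    simp only [Real.norm_eq_abs, sub_self] at h
    rw [mul_assoc ε, ← pow_two, sq_abs] at h
    have e : F y - F x - f x * (y - x) - f' x / 2 * (y - x) ^ 2 =
        F y - f x * (y - x) - f' x / 2 * (y - x) ^ 2 - (F x - f x * 0 - f' x / 2 * 0 ^ 2) := by ring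
    rw [e]
    have : 0 ≤ 2 * B / δ ^ 2 * (y - x) ^ 4 := by positivity
    linarith
  · have h1 := abs_taylor_one_le hf hf' hB hx hy
    have h2 := hB x hx
    have h3 : |f' x / 2 * (y - x) ^ 2| ≤ B * (y - x) ^ 2 := by
      rw [abs_mul, abs_of_nonneg (sq_nonneg (y - x)), abs_div, abs_two]
      gcongr
      linarith [abs_nonneg (f' x)]
    have h4 : 2 * B * (y - x) ^ 2 ≤ 2 * B / δ ^ 2 * (y - x) ^ 4 := by
      rw [div_mul_eq_mul_div, le_div_iff₀ (by positivity)]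
      have : δ ^ 2 ≤ (y - x) ^ 2 := by
        rw [← sq_abs (y - x)]; gcongr
      calc _ ≤ 2 * B * (y - x) ^ 2 * (y - x) ^ 2 := by gcongr
        _ = _ := by ring
    have := abs_sub (F y - F x - f x * (y - x)) (f' x / 2 * (y - x) ^ 2)
    have : 0 ≤ ε * (y - x) ^ 2 := by positivity
    linarith

/-! ### The Szasz-Mirakyan operator as a Poisson expectation, and its bias. -/

theorem coe_toNNReal_natCast_mul (m : ℕ) {x : ℝ} (hx : 0 ≤ x) :
    (((m * x : ℝ).toNNReal : ℝ≥0) : ℝ) = m * x :=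
  Real.coe_toNNReal _ (by positivity)

theorem operator_eq_integral (m : ℕ) (u : ℝ → ℝ) {x : ℝ} (hx : 0 ≤ x) :
    operator m u x = ∫ k : ℕ, u (k / m) ∂poissonMeasure (m * x).toNNReal := by
  rw [integral_poissonMeasure, operator]
  refine tsum_congr fun k => ?_
  rw [coe_toNNReal_natCast_mul m hx, weight, smul_eq_mul, mul_comm]

section Moments

variable {m : ℕ} {x : ℝ}

theorem integrable_div_sub_pow (m : ℕ) (x : ℝ) (r : ℝ≥0) (j : ℕ) :
    Integrable (fun k : ℕ => ((k : ℝ) / m - x) ^ j) (poissonMeasure r) := by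
  rcases Nat.eq_zero_or_pos m with rfl | hm
  · simp
  have hm' : (m : ℝ) ≠ 0 := by positivity
  have e : ∀ k : ℕ, ((k : ℝ) / m - x) ^ j = ((k : ℝ) - m * x) ^ j / m ^ j := fun k => by
    rw [← div_pow]; congr 1; field_simp
  simp only [e]
  exact (integrable_sub_pow_poissonMeasure _ _ _).div_const _

theorem integral_div_sub (hm : 0 < m) (hx : 0 ≤ x) :
    ∫ k : ℕ, ((k : ℝ) / m - x) ∂poissonMeasure (m * x).toNNReal = 0 := by
  have hm' : (m : ℝ) ≠ 0 := by positivity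
  rw [integral_sub ((integrable_natCast_poissonMeasure _).div_const _) (integrable_const _),
    integral_div, integral_natCast_poissonMeasure, coe_toNNReal_natCast_mul m hx]
  simp
  field_simp
  ring

theorem integral_div_sub_sq (hm : 0 < m) (hx : 0 ≤ x) :
    ∫ k : ℕ, ((k : ℝ) / m - x) ^ 2 ∂poissonMeasure (m * x).toNNReal = x / m := by
  have hm' : (m : ℝ) ≠ 0 := by positivity
  have e : ∀ k : ℕ, ((k : ℝ) / m - x) ^ 2 = ((k : ℝ) - (m * x).toNNReal) ^ 2 / m ^ 2 := fun k => by
    rw [← div_pow, coe_toNNReal_natCast_mul m hx]; congr 1; field_simp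
  simp only [e]
  rw [integral_div, integral_sub_sq_poissonMeasure, coe_toNNReal_natCast_mul m hx]
  field_simp

theorem integral_div_sub_fourth (hm : 0 < m) (hx : 0 ≤ x) :
    ∫ k : ℕ, ((k : ℝ) / m - x) ^ 4 ∂poissonMeasure (m * x).toNNReal =
      3 * x ^ 2 / m ^ 2 + x / m ^ 3 := by
  have hm' : (m : ℝ) ≠ 0 := by positivity
  have e : ∀ k : ℕ, ((k : ℝ) / m - x) ^ 4 = ((k : ℝ) - (m * x).toNNReal) ^ 4 / m ^ 4 := fun k => by
    rw [← div_pow, coe_toNNReal_natCast_mul m hx]; congr 1; field_simp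
  simp only [e]
  rw [integral_div, integral_sub_fourth_poissonMeasure, coe_toNNReal_natCast_mul m hx]
  field_simp

end Moments

theorem integrable_comp_div_poissonMeasure {F : ℝ → ℝ} (hF : ∀ y, |F y| ≤ 1) (m : ℕ) (r : ℝ≥0) :
    Integrable (fun k : ℕ => F (k / m)) (poissonMeasure r) :=
  Integrable.of_bound (C := 1) .of_discrete (ae_of_all _ fun _ => hF _)

/-- The bias bound of the Szasz-Mirakyan operator. -/
theorem abs_operator_sub_le {F f f' : ℝ → ℝ} {B : ℝ}
    (hf : ∀ x ∈ Set.Ici (0 : ℝ), HasDerivWithinAt F (f x) (Set.Ici 0) x)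
    (hf' : ∀ x ∈ Set.Ici (0 : ℝ), HasDerivWithinAt f (f' x) (Set.Ici 0) x)
    (hB : ∀ x ∈ Set.Ici (0 : ℝ), |f' x| ≤ B) (hF : ∀ y, |F y| ≤ 1) {m : ℕ} (hm : 0 < m) {x : ℝ}
    (hx : 0 ≤ x) : |operator m F x - F x| ≤ B * x / m := by
  have i0 := integrable_comp_div_poissonMeasure hF m (m * x).toNNReal
  have i1 := integrable_div_sub_pow m x (m * x).toNNReal 1
  have i2 := integrable_div_sub_pow m x (m * x).toNNReal 2
  simp only [pow_one] at i1
  have e : operator m F x - F x =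
      ∫ k : ℕ, (F (k / m) - F x - f x * (k / m - x)) ∂poissonMeasure (m * x).toNNReal := by
    rw [integral_sub (i0.sub' (integrable_const _)) (i1.const_mul _), integral_sub i0
      (integrable_const _),
      integral_const_mul, integral_div_sub hm hx, operator_eq_integral m F hx]
    simp
  rw [e, mul_div_assoc, ← integral_div_sub_sq hm hx, ← integral_const_mul]
  rw [← Real.norm_eq_abs]
  refine norm_integral_le_of_norm_le (i2.const_mul B) (ae_of_all _ fun k => ?_)
  exact abs_taylor_one_le hf hf' hB hx (by positivity)

/-- Voronovskaya's theorem for the Szasz-Mirakyan operator. -/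
theorem tendsto_mul_operator_sub {F f f' : ℝ → ℝ} {B : ℝ}
    (hf : ∀ x ∈ Set.Ici (0 : ℝ), HasDerivWithinAt F (f x) (Set.Ici 0) x)
    (hf' : ∀ x ∈ Set.Ici (0 : ℝ), HasDerivWithinAt f (f' x) (Set.Ici 0) x)
    (hB : ∀ x ∈ Set.Ici (0 : ℝ), |f' x| ≤ B) (hF : ∀ y, |F y| ≤ 1) {x : ℝ} (hx : 0 ≤ x) :
    Tendsto (fun m : ℕ => (m : ℝ) * (operator m F x - F x)) atTop (𝓝 (biasTerm f' x)) := by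
  have key : ∀ ε : ℝ, 0 < ε → ∃ C : ℝ, ∀ m : ℕ, 0 < m →
      |(m : ℝ) * (operator m F x - F x) - biasTerm f' x| ≤
        ε * x + C * (3 * x ^ 2 / m + x / m ^ 2) := by
    intro ε hε
    obtain ⟨C, hC⟩ := exists_abs_taylor_two_le hf hf' hB hx hε
    refine ⟨C, fun m hm => ?_⟩
    have hm' : (0 : ℝ) < m := by positivity
    have i0 := integrable_comp_div_poissonMeasure hF m (m * x).toNNReal
    have i1 := integrable_div_sub_pow m x (m * x).toNNReal 1
    have i2 := integrable_div_sub_pow m x (m * x).toNNReal 2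
    have i4 := integrable_div_sub_pow m x (m * x).toNNReal 4
    simp only [pow_one] at i1
    have e : (m : ℝ) * (operator m F x - F x) - biasTerm f' x =
        m * ∫ k : ℕ, (F (k / m) - F x - f x * (k / m - x) - f' x / 2 * (k / m - x) ^ 2)
          ∂poissonMeasure (m * x).toNNReal := by
      rw [integral_sub ((i0.sub' (integrable_const _)).sub' (i1.const_mul _)) (i2.const_mul _),
        integral_sub (i0.sub' (integrable_const _)) (i1.const_mul _), integral_sub i0
          (integrable_const _),
        integral_const_mul, integral_const_mul, integral_div_sub hm hx, integral_div_sub_sq hm hx,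
        operator_eq_integral m F hx, biasTerm]
      simp
      field_simp
    have h : |∫ k : ℕ, (F (k / m) - F x - f x * (k / m - x) - f' x / 2 * (k / m - x) ^ 2)
          ∂poissonMeasure (m * x).toNNReal| ≤
        ∫ k : ℕ, (ε * ((k : ℝ) / m - x) ^ 2 + C * ((k : ℝ) / m - x) ^ 4)
          ∂poissonMeasure (m * x).toNNReal := by
      rw [← Real.norm_eq_abs]
      refine norm_integral_le_of_norm_le (integrable_fun_add (i2.const_mul _) (i4.const_mul _))
        (ae_of_all _ fun k => ?_)
      exact hC _ (by positivity)
    rw [integral_add (by fun_prop) (by fun_prop), integral_const_mul, integral_const_mul,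
      integral_div_sub_sq hm hx, integral_div_sub_fourth hm hx] at h
    rw [e, abs_mul, abs_of_pos hm']
    refine (mul_le_mul_of_nonneg_left h hm'.le).trans (le_of_eq ?_)
    field_simp
  rw [Metric.tendsto_atTop']
  intro η hη
  -- This `ε` makes `ε x ≤ η/2`; `x + 1` instead of `x` keeps the denominator positive at `x = 0`.
  obtain ⟨C, hC⟩ := key (η / (2 * (x + 1))) (by positivity)
  have hlim : Tendsto (fun m : ℕ => C * (3 * x ^ 2 / m + x / (m : ℝ) ^ 2)) atTop (𝓝 0) := by
    have h1 : Tendsto (fun m : ℕ => 3 * x ^ 2 / (m : ℝ)) atTop (𝓝 0) :=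
      tendsto_const_nhds.div_atTop tendsto_natCast_atTop_atTop
    have h2 : Tendsto (fun m : ℕ => x / (m : ℝ) ^ 2) atTop (𝓝 0) :=
      tendsto_const_nhds.div_atTop
        ((tendsto_pow_atTop two_ne_zero).comp tendsto_natCast_atTop_atTop)
    simpa using (h1.add h2).const_mul C
  obtain ⟨N, hN⟩ := eventually_atTop.1
    ((hlim.eventually_lt_const (half_pos hη)).and (eventually_gt_atTop 0))
  refine ⟨N, fun m hm => ?_⟩
  obtain ⟨h1, h2⟩ := hN m hm.le
  have h3 : η / (2 * (x + 1)) * x ≤ η / 2 := by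
    rw [div_mul_eq_mul_div, div_le_div_iff₀ (by positivity) (by positivity)]
    nlinarith
  rw [Real.dist_eq]
  linarith [hC m h2]

/-! ### Variance of the contribution of one observation. -/

/-- The second moment `E[F(min(K, L) / m)]` of `E[𝟙(X ≤ K / m) | X]`, for independent Poisson
variables `K`, `L` with parameter `m x`. -/
noncomputable def secondMoment (m : ℕ) (F : ℝ → ℝ) (x : ℝ) : ℝ :=
  operator m (fun y => operator m (fun z => F (min y z)) x) x

theorem secondMoment_eq_integral {F : ℝ → ℝ} (hF : ∀ y, |F y| ≤ 1) (m : ℕ) {x : ℝ} (hx : 0 ≤ x) :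
    secondMoment m F x = ∫ p : ℕ × ℕ, F (min ((p.1 : ℝ) / m) (p.2 / m))
      ∂(poissonMeasure (m * x).toNNReal).prod (poissonMeasure (m * x).toNNReal) := by
  rw [secondMoment, operator_eq_integral m _ hx, integral_prod]
  · simp only [operator_eq_integral m _ hx]
  · exact Integrable.of_bound (C := 1) .of_discrete (ae_of_all _ fun _ => hF _)

/-- The scaled mean absolute difference of two independent Poisson variables. -/
noncomputable def poissonGap (m : ℕ) (x : ℝ) : ℝ :=
  ∫ p : ℕ × ℕ, |((p.1 : ℝ) - p.2) / √m|
    ∂(poissonMeasure (m * x).toNNReal).prod (poissonMeasure (m * x).toNNReal)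

theorem integrable_abs_sub_div_sqrt (m : ℕ) (r : ℝ≥0) :
    Integrable (fun p : ℕ × ℕ => |((p.1 : ℝ) - p.2) / √m|)
      ((poissonMeasure r).prod (poissonMeasure r)) := by
  have h := integrable_natCast_poissonMeasure r
  exact (((h.comp_fst _).sub (h.comp_snd _)).div_const _).abs

theorem poissonGap_nonneg (m : ℕ) (x : ℝ) : 0 ≤ poissonGap m x :=
  integral_nonneg fun _ => abs_nonneg _

/-- `|z| ≤ 1 + z²` and `E(K - L)²/m = 2x`. The bound does not depend on `m`, as domination requires.
-/
theorem poissonGap_le {m : ℕ} (hm : 0 < m) {x : ℝ} (hx : 0 ≤ x) : poissonGap m x ≤ 1 + 2 * x := by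
  have hm' : (0 : ℝ) < m := by positivity
  have hsq := (integrable_sub_sq_prod_poissonMeasure (m * x).toNNReal).div_const (m : ℝ)
  have e : 1 + 2 * x = ∫ p : ℕ × ℕ, (1 + ((p.1 : ℝ) - p.2) ^ 2 / m)
      ∂(poissonMeasure (m * x).toNNReal).prod (poissonMeasure (m * x).toNNReal) := by
    rw [integral_add (integrable_const _) hsq, integral_div, integral_sub_sq_prod_poissonMeasure,
      coe_toNNReal_natCast_mul m hx]
    simp
    field_simp
  rw [e]
  refine integral_mono (integrable_abs_sub_div_sqrt _ _) ((integrable_const _).add hsq) fun p => ?_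
  have h : ((p.1 : ℝ) - p.2) ^ 2 / m = |((p.1 : ℝ) - p.2) / √m| ^ 2 := by
    rw [sq_abs, div_pow, Real.sq_sqrt hm'.le]
  simp only [h]
  nlinarith [sq_nonneg (|((p.1 : ℝ) - p.2) / √m| - 1), abs_nonneg (((p.1 : ℝ) - p.2) / √m)]

/-- Expand `F` at `x` along `min(K, L)/m`. The centred variables have mean zero, so only the `|K -
L|` part of the minimum survives at first order; the quadratic remainder is at most `B` times the
sum of the two variances `x/m`. -/
theorem abs_secondMoment_sub_le {F f f' : ℝ → ℝ} {B : ℝ}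
    (hf : ∀ x ∈ Set.Ici (0 : ℝ), HasDerivWithinAt F (f x) (Set.Ici 0) x)
    (hf' : ∀ x ∈ Set.Ici (0 : ℝ), HasDerivWithinAt f (f' x) (Set.Ici 0) x)
    (hB : ∀ x ∈ Set.Ici (0 : ℝ), |f' x| ≤ B) (hF : ∀ y, |F y| ≤ 1) {m : ℕ} (hm : 0 < m) {x : ℝ}
    (hx : 0 ≤ x) :
    |secondMoment m F x - F x + f x * poissonGap m x / (2 * √m)| ≤ 2 * B * x / m := by
  have hB0 : 0 ≤ B := (abs_nonneg _).trans (hB 0 Set.self_mem_Ici)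
  have hm' : (0 : ℝ) < m := by positivity
  have hs : 0 < √(m : ℝ) := Real.sqrt_pos.2 hm'
  set π := poissonMeasure (m * x).toNNReal with hπ
  have i1 := integrable_div_sub_pow m x (m * x).toNNReal 1
  have i2 := integrable_div_sub_pow m x (m * x).toNNReal 2
  simp only [pow_one] at i1
  have j1 := i1.comp_fst π
  have j2 := i1.comp_snd π
  have k1 := i2.comp_fst π
  have k2 := i2.comp_snd π
  have ja := integrable_abs_sub_div_sqrt m (m * x).toNNReal
  rw [← hπ] at j1 j2 k1 k2 ja
  have hFi : Integrable (fun p : ℕ × ℕ => F (min ((p.1 : ℝ) / m) (p.2 / m))) (π.prod π) :=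
    Integrable.of_bound (C := 1) .of_discrete (ae_of_all _ fun _ => hF _)
  have hmin : ∀ p : ℕ × ℕ, min ((p.1 : ℝ) / m) (p.2 / m) - x =
      (((p.1 : ℝ) / m - x) + ((p.2 : ℝ) / m - x) - |((p.1 : ℝ) - p.2) / √m| / √m) / 2 := fun p => by
    rw [min_eq_add_sub_abs_div_two, abs_div, abs_of_pos hs, div_div, Real.mul_self_sqrt hm'.le,
      ← sub_div, abs_div, abs_of_pos hm']
    ring
  have hmi : Integrable (fun p : ℕ × ℕ => min ((p.1 : ℝ) / m) (p.2 / m) - x) (π.prod π) := by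
    simp only [hmin]
    exact ((j1.add j2).sub (ja.div_const _)).div_const _
  have hmean : ∫ p : ℕ × ℕ, (min ((p.1 : ℝ) / m) (p.2 / m) - x) ∂π.prod π =
      -(poissonGap m x / (2 * √m)) := by
    simp only [hmin]
    rw [integral_div, integral_sub (integrable_fun_add j1 j2) (ja.div_const _),
      integral_add j1 j2, integral_div,
      integral_fun_fst (fun k : ℕ => (k : ℝ) / m - x),
      integral_fun_snd (fun k : ℕ => (k : ℝ) / m - x), integral_div_sub hm hx, ← poissonGap]
    simp
    field_simp
  have e : secondMoment m F x - F x + f x * poissonGap m x / (2 * √m) =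
      ∫ p : ℕ × ℕ, (F (min ((p.1 : ℝ) / m) (p.2 / m)) - F x -
        f x * (min ((p.1 : ℝ) / m) (p.2 / m) - x)) ∂π.prod π := by
    rw [integral_sub (hFi.sub' (integrable_const _)) (hmi.const_mul _),
      integral_sub hFi (integrable_const _), integral_const_mul, hmean,
      secondMoment_eq_integral hF m hx]
    simp
    ring
  have e2 : 2 * B * x / m =
      ∫ p : ℕ × ℕ, B * (((p.1 : ℝ) / m - x) ^ 2 + ((p.2 : ℝ) / m - x) ^ 2) ∂π.prod π := by
    rw [integral_const_mul, integral_add k1 k2,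
      integral_fun_fst (fun k : ℕ => ((k : ℝ) / m - x) ^ 2),
      integral_fun_snd (fun k : ℕ => ((k : ℝ) / m - x) ^ 2), integral_div_sub_sq hm hx]
    simp
    ring
  rw [e, e2]
  rw [← Real.norm_eq_abs]
  refine norm_integral_le_of_norm_le ((integrable_fun_add k1 k2).const_mul B)
    (ae_of_all _ fun p => ?_)
  refine (abs_taylor_one_le hf hf' hB hx (by positivity)).trans ?_
  refine mul_le_mul_of_nonneg_left ?_ hB0
  rcases min_choice ((p.1 : ℝ) / m) ((p.2 : ℝ) / m) with h | h <;> rw [h] <;>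
    nlinarith [sq_nonneg ((p.1 : ℝ) / m - x), sq_nonneg ((p.2 : ℝ) / m - x)]

/-- The variance of `E[𝟙(X ≤ K / m) | X]` minus `σ²(x)`, scaled. -/
noncomputable def scaledVarDiff (m : ℕ) (F : ℝ → ℝ) (x : ℝ) : ℝ :=
  √m * (secondMoment m F x - operator m F x ^ 2 - sigmaSq F x)

theorem abs_operator_le_one {F : ℝ → ℝ} (hF : ∀ y, |F y| ≤ 1) (m : ℕ) {x : ℝ} (hx : 0 ≤ x) :
    |operator m F x| ≤ 1 := by
  rw [operator_eq_integral m F hx]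
  simpa using norm_integral_le_of_norm_le_const (μ := poissonMeasure (m * x).toNNReal) (C := 1)
    (f := fun k : ℕ => F (k / m)) (ae_of_all _ fun k => hF _)

/-- Replacing `(S_m F)²` by `F²` costs `(S_m F - F)(S_m F + F) = O(x/m)`, so after scaling by `√m`
only the gap term is of order one. -/
theorem abs_scaledVarDiff_add_le {F f f' : ℝ → ℝ} {B : ℝ}
    (hf : ∀ x ∈ Set.Ici (0 : ℝ), HasDerivWithinAt F (f x) (Set.Ici 0) x)
    (hf' : ∀ x ∈ Set.Ici (0 : ℝ), HasDerivWithinAt f (f' x) (Set.Ici 0) x)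
    (hB : ∀ x ∈ Set.Ici (0 : ℝ), |f' x| ≤ B) (hF : ∀ y, |F y| ≤ 1) {m : ℕ} (hm : 0 < m) {x : ℝ}
    (hx : 0 ≤ x) :
    |scaledVarDiff m F x + f x * poissonGap m x / 2| ≤ 4 * B * x / √m := by
  have hm' : (0 : ℝ) < m := by positivity
  have hs : 0 < √(m : ℝ) := Real.sqrt_pos.2 hm'
  have hss : √(m : ℝ) * √m = m := Real.mul_self_sqrt hm'.le
  have h1 := abs_secondMoment_sub_le hf hf' hB hF hm hx
  have h2 := abs_operator_sub_le hf hf' hB hF hm hx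
  have h3 : |operator m F x + F x| ≤ 2 := by
    have := abs_add_le (operator m F x) (F x)
    linarith [hF x, abs_operator_le_one hF m hx]
  have e : scaledVarDiff m F x + f x * poissonGap m x / 2 =
      √m * ((secondMoment m F x - F x + f x * poissonGap m x / (2 * √m)) -
        (operator m F x - F x) * (operator m F x + F x)) := by
    rw [scaledVarDiff, sigmaSq]
    field_simp
    ring
  have h4 : |(operator m F x - F x) * (operator m F x + F x)| ≤ B * x / m * 2 := by
    rw [abs_mul]
    gcongr
    exact (abs_nonneg _).trans h2
  rw [e, abs_mul, abs_of_pos hs]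
  have h5 := (abs_sub (secondMoment m F x - F x + f x * poissonGap m x / (2 * √m))
    ((operator m F x - F x) * (operator m F x + F x))).trans (add_le_add h1 h4)
  refine (mul_le_mul_of_nonneg_left h5 hs.le).trans (le_of_eq ?_)
  field_simp
  rw [pow_two, hss]
  ring

theorem abs_scaledVarDiff_le {F f f' : ℝ → ℝ} {B B₁ : ℝ}
    (hf : ∀ x ∈ Set.Ici (0 : ℝ), HasDerivWithinAt F (f x) (Set.Ici 0) x)
    (hf' : ∀ x ∈ Set.Ici (0 : ℝ), HasDerivWithinAt f (f' x) (Set.Ici 0) x)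
    (hB : ∀ x ∈ Set.Ici (0 : ℝ), |f' x| ≤ B) (hB₁ : ∀ x ∈ Set.Ici (0 : ℝ), |f x| ≤ B₁)
    (hF : ∀ y, |F y| ≤ 1) {m : ℕ} (hm : 0 < m) {x : ℝ} (hx : 0 ≤ x) :
    |scaledVarDiff m F x| ≤ B₁ * (1 + 2 * x) + 4 * B * x := by
  have hB0 : 0 ≤ B := (abs_nonneg _).trans (hB 0 Set.self_mem_Ici)
  have hB10 : 0 ≤ B₁ := (abs_nonneg _).trans (hB₁ 0 Set.self_mem_Ici)
  have h1 := abs_scaledVarDiff_add_le hf hf' hB hF hm hx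
  have h2 : 4 * B * x / √m ≤ 4 * B * x :=
    div_le_self (by positivity) (Real.one_le_sqrt.2 (by exact_mod_cast hm))
  have h3 : |f x * poissonGap m x / 2| ≤ B₁ * (1 + 2 * x) := by
    rw [abs_div, abs_mul, abs_two, abs_of_nonneg (poissonGap_nonneg m x)]
    have : |f x| * poissonGap m x ≤ B₁ * (1 + 2 * x) :=
      mul_le_mul (hB₁ x hx) (poissonGap_le hm hx) (poissonGap_nonneg m x) hB10
    have h0 : 0 ≤ |f x| * poissonGap m x := mul_nonneg (abs_nonneg _) (poissonGap_nonneg m x)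
    linarith
  have := abs_sub (scaledVarDiff m F x + f x * poissonGap m x / 2) (f x * poissonGap m x / 2)
  rw [add_sub_cancel_right] at this
  linarith

theorem tendsto_scaledVarDiff {F f f' : ℝ → ℝ} {B : ℝ}
    (hf : ∀ x ∈ Set.Ici (0 : ℝ), HasDerivWithinAt F (f x) (Set.Ici 0) x)
    (hf' : ∀ x ∈ Set.Ici (0 : ℝ), HasDerivWithinAt f (f' x) (Set.Ici 0) x)
    (hB : ∀ x ∈ Set.Ici (0 : ℝ), |f' x| ≤ B) (hF : ∀ y, |F y| ≤ 1) {x : ℝ} (hx : 0 < x) :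
    Tendsto (fun m : ℕ => scaledVarDiff m F x) atTop (𝓝 (-varTerm f x)) := by
  have hg : Tendsto (fun m : ℕ => poissonGap m x) atTop (𝓝 (2 * √(x / Real.pi))) :=
    tendsto_integral_abs_sub_poissonMeasure hx
  have h0 : Tendsto (fun m : ℕ => scaledVarDiff m F x + f x * poissonGap m x / 2) atTop (𝓝 0) := by
    have hz : Tendsto (fun m : ℕ => 4 * B * x / √(m : ℝ)) atTop (𝓝 0) :=
      tendsto_const_nhds.div_atTop (Real.tendsto_sqrt_atTop.comp tendsto_natCast_atTop_atTop)
    refine squeeze_zero_norm' ?_ hz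
    filter_upwards [eventually_gt_atTop 0] with m hm
    exact abs_scaledVarDiff_add_le hf hf' hB hF hm hx.le
  have h := h0.sub ((hg.const_mul (f x)).div_const 2)
  simp only [add_sub_cancel_right] at h
  convert h using 2
  rw [varTerm]
  ring

/-! ### Measurability and bounds for the estimator. -/

theorem measurable_operator {Z : Type*} [MeasurableSpace Z] (m : ℕ) {u : Z → ℝ → ℝ} {g : Z → ℝ}
    {B : ℝ} (hu : ∀ t, Measurable fun z => u z t) (hg : Measurable g) (hB : ∀ z t, |u z t| ≤ B) :
    Measurable fun z => operator m (u z) (g z) := by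
  refine measurable_of_tendsto_metrizable
    (f := fun (n : ℕ) z => ∑ k ∈ Finset.range n, u z ((k : ℝ) / m) * weight k m (g z))
    (fun n => Finset.measurable_fun_sum _ fun k _ => (hu _).mul ?_) (tendsto_pi_nhds.2 fun z => ?_)
  · unfold weight
    fun_prop
  · exact (summable_operator m (u z) (g z) B (hB z)).hasSum.tendsto_sum_nat

theorem empiricalCdf_mem_Icc (d : ℕ → ℝ) (n : ℕ) (x : ℝ) :
    empiricalCdf d n x ∈ Set.Icc (0 : ℝ) 1 := by
  have h0 : ∀ i, 0 ≤ (Set.Iic x).indicator (fun _ => (1 : ℝ)) (d i) := fun i =>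
    Set.indicator_nonneg (fun _ _ => zero_le_one) _
  have h1 : ∀ i, (Set.Iic x).indicator (fun _ => (1 : ℝ)) (d i) ≤ 1 := fun i =>
    Set.indicator_le_self' (fun _ _ => zero_le_one) _
  refine ⟨mul_nonneg (by positivity) (Finset.sum_nonneg fun i _ => h0 i), ?_⟩
  have h := Finset.sum_le_sum fun i (_ : i ∈ Finset.range n) => h1 i
  simp only [Finset.sum_const, Finset.card_range, nsmul_eq_mul, mul_one] at h
  refine (mul_le_mul_of_nonneg_left h (by positivity)).trans ?_
  exact inv_mul_le_one

theorem abs_empiricalCdf_le_one (d : ℕ → ℝ) (n : ℕ) (x : ℝ) : |empiricalCdf d n x| ≤ 1 := by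
  have h := empiricalCdf_mem_Icc d n x
  rw [abs_of_nonneg h.1]
  exact h.2

theorem measurable_indicator_Iic_one (y : ℝ) :
    Measurable ((Set.Iic y).indicator fun _ : ℝ => (1 : ℝ)) :=
  measurable_const.indicator measurableSet_Iic

theorem abs_indicator_Iic_one_le (y t : ℝ) : |(Set.Iic y).indicator (fun _ : ℝ => (1 :
    ℝ)) t| ≤ 1 := by
  by_cases h : t ∈ Set.Iic y <;> simp [h]

theorem measurable_estimator {Ω : Type*} [MeasurableSpace Ω] {X : ℕ → Ω → ℝ}
    (hX : ∀ i, Measurable (X i)) (m n : ℕ) :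
    Measurable fun z : Ω × ℝ => estimator (fun i => X i z.1) m n z.2 := by
  refine measurable_operator m (B := 1) (fun t => ?_) measurable_snd
    fun _ _ => abs_empiricalCdf_le_one _ _ _
  refine (Finset.measurable_fun_sum _ fun i _ => ?_).const_mul _
  exact (measurable_indicator_Iic_one t).comp ((hX i).comp measurable_fst)

theorem aestronglyMeasurable_secondMoment {F : ℝ → ℝ} (hF : ∀ y, |F y| ≤ 1) (m : ℕ) :
    AEStronglyMeasurable (secondMoment m F) (volume.restrict (Set.Ioi 0)) := by
  -- The inner operator is known to be bounded by `1` only for `x ≥ 0`, where the weights are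
  -- probabilities; truncating at `0` changes nothing on `(0, ∞)`.
  have h : Measurable fun x : ℝ =>
      operator m (fun y => operator m (fun z => F (min y z)) (max x 0)) (max x 0) :=
    measurable_operator m (B := 1)
      (fun t => measurable_operator m (fun _ => measurable_const)
        (measurable_id.max measurable_const) fun _ _ => hF _)
      (measurable_id.max measurable_const)
      fun _ _ => abs_operator_le_one (fun _ => hF _) m (le_max_right _ _)
  refine h.aestronglyMeasurable.congr ?_
  filter_upwards [ae_restrict_mem measurableSet_Ioi] with x hx
  rw [max_eq_left (Set.mem_Ioi.1 hx).le, secondMoment]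

theorem abs_cdf_le_one (ν : Measure ℝ) (y : ℝ) : |cdf ν y| ≤ 1 := by
  rw [abs_of_nonneg (cdf_nonneg ν y)]
  exact cdf_le_one ν y

/-! ### Mean and second moment of the summands; bias-variance identity. -/

section Moments

variable (ν : Measure ℝ) [IsProbabilityMeasure ν]

theorem integrable_indicator_Iic_prod {K : Type*} [MeasurableSpace K] (π : Measure K)
    [IsProbabilityMeasure π] {b : K → ℝ} (hb : Measurable b) :
    Integrable (Function.uncurry fun (t : ℝ) (k : K) =>
      (Set.Iic (b k)).indicator (fun _ => (1 : ℝ)) t) (ν.prod π) := by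
  refine Integrable.of_bound (C := 1) (Measurable.aestronglyMeasurable ?_)
    (ae_of_all _ fun z => abs_indicator_Iic_one_le _ _)
  exact (measurable_const (a := (1 : ℝ))).indicator
    (measurableSet_le measurable_fst (hb.comp measurable_snd))

theorem integral_integral_indicator_Iic {K : Type*} [MeasurableSpace K] (π : Measure K)
    [IsProbabilityMeasure π] {b : K → ℝ} (hb : Measurable b) :
    ∫ t, ∫ k, (Set.Iic (b k)).indicator (fun _ => (1 : ℝ)) t ∂π ∂ν = ∫ k, cdf ν (b k) ∂π := by
  rw [integral_integral_swap (integrable_indicator_Iic_prod ν π hb)]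
  refine integral_congr_ae (ae_of_all _ fun k => ?_)
  simp only
  rw [integral_indicator_const _ measurableSet_Iic, cdf_eq_real, smul_eq_mul, mul_one]

/-- The contribution `∑ₖ 𝟙(t ≤ k / m) V_{k,m}(x)` of one observation `t` to the estimator. -/
noncomputable def kernelCdf (m : ℕ) (x t : ℝ) : ℝ :=
  operator m (fun y => (Set.Iic y).indicator (fun _ => (1 : ℝ)) t) x

theorem measurable_kernelCdf (m : ℕ) (x : ℝ) : Measurable (kernelCdf m x) :=
  measurable_operator m (u := fun t y => (Set.Iic y).indicator (fun _ => (1 : ℝ)) t)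
    measurable_indicator_Iic_one measurable_const fun _ _ => abs_indicator_Iic_one_le _ _

theorem abs_kernelCdf_le_one (m : ℕ) {x : ℝ} (hx : 0 ≤ x) (t : ℝ) : |kernelCdf m x t| ≤ 1 :=
  abs_operator_le_one (fun _ => abs_indicator_Iic_one_le _ _) m hx

theorem estimator_eq_sum_kernelCdf (d : ℕ → ℝ) (m n : ℕ) {x : ℝ} (hx : 0 ≤ x) :
    estimator d m n x = (n : ℝ)⁻¹ * ∑ i ∈ Finset.range n, kernelCdf m x (d i) := by
  rw [estimator, operator_eq_integral m _ hx]
  simp only [empiricalCdf, kernelCdf, operator_eq_integral m _ hx]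
  rw [integral_const_mul, integral_finsetSum]
  exact fun i _ => Integrable.of_bound (C := 1) .of_discrete
    (ae_of_all _ fun _ => abs_indicator_Iic_one_le _ _)

theorem integral_kernelCdf (m : ℕ) {x : ℝ} (hx : 0 ≤ x) :
    ∫ t, kernelCdf m x t ∂ν = operator m (cdf ν) x := by
  simp only [kernelCdf, operator_eq_integral m _ hx]
  exact integral_integral_indicator_Iic ν _ .of_discrete

/-- The square of an expectation over `K` is an expectation over independent `(K, L)`, and a product
of indicators of half-lines is the indicator at the minimum. Fubini then integrates out `t`. -/
theorem integral_kernelCdf_sq (m : ℕ) {x : ℝ} (hx : 0 ≤ x) :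
    ∫ t, kernelCdf m x t ^ 2 ∂ν = secondMoment m (cdf ν) x := by
  rw [secondMoment_eq_integral (abs_cdf_le_one ν) m hx,
    ← integral_integral_indicator_Iic ν _ (b := fun p : ℕ × ℕ => min ((p.1 : ℝ) / m) (p.2 / m))
      .of_discrete]
  refine integral_congr_ae (ae_of_all _ fun t => ?_)
  simp only [kernelCdf, operator_eq_integral m _ hx, pow_two]
  rw [← integral_prod_mul]
  refine integral_congr_ae (ae_of_all _ fun p => ?_)
  simp only [← Set.Iic_inter_Iic]
  rw [← Set.inter_indicator_mul]
  simp

end Moments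

theorem integral_sq_sub_const {Ω : Type*} [MeasurableSpace Ω] (P : Measure Ω)
    [IsProbabilityMeasure P] {W : Ω → ℝ} (hW : MemLp W 2 P) (c : ℝ) :
    ∫ ω, (W ω - c) ^ 2 ∂P = Var[W; P] + (∫ ω, W ω ∂P - c) ^ 2 := by
  have h := variance_eq_sub (hW.sub (memLp_const c))
  have h2 := variance_sub_const hW.aestronglyMeasurable c
  have h3 : ∫ ω, (W ω - c) ∂P = ∫ ω, W ω ∂P - c := by
    rw [integral_sub (hW.integrable (by norm_num)) (integrable_const _)]
    simp
  rw [← h3, ← h2]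
  simp only [Pi.sub_def, Pi.pow_def] at h
  rw [h]
  ring

/-- Bias-variance decomposition; by pairwise independence the variance of the mean is `n⁻¹` times
that of one summand. -/
theorem integral_sq_mean_sub_const {Ω : Type*} [MeasurableSpace Ω] (P : Measure Ω)
    [IsProbabilityMeasure P] {X : ℕ → Ω → ℝ} (ν : Measure ℝ) [IsProbabilityMeasure ν]
    (hX : ∀ i, Measurable (X i)) (hlaw : ∀ i, P.map (X i) = ν) (hindep : iIndepFun X P)
    {G : ℝ → ℝ} (hG : Measurable G) (hG1 : ∀ t, |G t| ≤ 1) (c : ℝ) {n : ℕ} (hn : 0 < n) :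
    ∫ ω, ((n : ℝ)⁻¹ * ∑ i ∈ Finset.range n, G (X i ω) - c) ^ 2 ∂P =
      (n : ℝ)⁻¹ * (∫ t, G t ^ 2 ∂ν - (∫ t, G t ∂ν) ^ 2) + (∫ t, G t ∂ν - c) ^ 2 := by
  have hn' : (n : ℝ) ≠ 0 := by positivity
  have hY : ∀ i, MemLp (fun ω => G (X i ω)) 2 P := fun i =>
    MemLp.of_bound (hG.comp (hX i)).aestronglyMeasurable 1 (ae_of_all _ fun ω => hG1 _)
  have hS : MemLp (∑ i ∈ Finset.range n, fun ω => G (X i ω)) 2 P :=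
    memLp_finsetSum' _ fun i _ => hY i
  have hmean : ∀ i, ∫ ω, G (X i ω) ∂P = ∫ t, G t ∂ν := fun i => by
    rw [← hlaw i, integral_map (hX i).aemeasurable hG.aestronglyMeasurable]
  have hsq : ∀ i, ∫ ω, G (X i ω) ^ 2 ∂P = ∫ t, G t ^ 2 ∂ν := fun i => by
    rw [← hlaw i, integral_map (hX i).aemeasurable (hG.pow_const 2).aestronglyMeasurable]
  have hvar : ∀ i, Var[fun ω => G (X i ω); P] = ∫ t, G t ^ 2 ∂ν - (∫ t, G t ∂ν) ^ 2 := fun i => by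
    rw [variance_eq_sub (hY i), hmean]
    simp only [Pi.pow_def, hsq]
  have hsum : Var[∑ i ∈ Finset.range n, fun ω => G (X i ω); P] =
      n * (∫ t, G t ^ 2 ∂ν - (∫ t, G t ∂ν) ^ 2) := by
    rw [IndepFun.variance_sum (fun i _ => hY i)
      (fun i _ j _ hij => (hindep.indepFun hij).comp hG hG)]
    simp only [hvar, Finset.sum_const, Finset.card_range, nsmul_eq_mul]
  have h := integral_sq_sub_const P (hS.const_mul (n : ℝ)⁻¹) c
  rw [variance_const_mul, hsum] at h
  simp only [Finset.sum_apply] at h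
  rw [h, integral_const_mul, integral_finsetSum _ fun i _ => (hY i).integrable (by norm_num)]
  simp only [hmean, Finset.sum_const, Finset.card_range, nsmul_eq_mul]
  field_simp

/-! ### Dominated convergence against the weight `e^{-ax} f(x)`. -/

section Weight

variable {f : ℝ → ℝ} {a B : ℝ}

theorem integrableOn_one_add_sq_mul_exp (ha : 0 < a) (C : ℝ) :
    IntegrableOn (fun x : ℝ => C * (1 + x ^ 2) * Real.exp (-(a * x))) (Set.Ioi 0) := by
  have h0 := integrableOn_rpow_mul_exp_neg_mul_rpow (s := 0) (p := 1) (b := a)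
    (by norm_num) one_pos ha
  have h2 := integrableOn_rpow_mul_exp_neg_mul_rpow (s := 2) (p := 1) (b := a)
    (by norm_num) one_pos ha
  refine ((h0.add h2).const_mul C).congr (ae_of_all _ fun x => ?_)
  simp only [Pi.add_apply, Real.rpow_zero, Real.rpow_one, Real.rpow_two]
  rw [neg_mul]
  ring

theorem norm_weighted_le (hB : ∀ x ∈ Set.Ici (0 : ℝ), |f x| ≤ B) {h : ℝ → ℝ} {C : ℝ} {x : ℝ}
    (hx : 0 < x) (hh : |h x| ≤ C * (1 + x ^ 2)) :
    ‖weighted f a h x‖ ≤ C * B * (1 + x ^ 2) * Real.exp (-(a * x)) := by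
  rw [weighted, Real.norm_eq_abs, abs_mul, abs_mul, Real.abs_exp]
  calc _ ≤ C * (1 + x ^ 2) * (Real.exp (-(a * x)) * B) :=
        mul_le_mul hh (mul_le_mul_of_nonneg_left (hB x hx.le) (Real.exp_pos _).le) (by positivity)
          ((abs_nonneg _).trans hh)
    _ = _ := by ring

theorem aestronglyMeasurable_weighted (hf : ContinuousOn f (Set.Ici 0)) {h : ℝ → ℝ}
    (hm : AEStronglyMeasurable h (volume.restrict (Set.Ioi 0))) :
    AEStronglyMeasurable (weighted f a h) (volume.restrict (Set.Ioi 0)) :=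
  hm.mul ((by fun_prop : Continuous fun x : ℝ => Real.exp (-(a * x))).aestronglyMeasurable.mul
    ((hf.mono Set.Ioi_subset_Ici_self).aestronglyMeasurable measurableSet_Ioi))

theorem integrableOn_weighted (ha : 0 < a) (hf : ContinuousOn f (Set.Ici 0))
    (hB : ∀ x ∈ Set.Ici (0 : ℝ), |f x| ≤ B) {h : ℝ → ℝ}
    (hm : AEStronglyMeasurable h (volume.restrict (Set.Ioi 0))) {C : ℝ}
    (hh : ∀ x, 0 < x → |h x| ≤ C * (1 + x ^ 2)) :
    IntegrableOn (weighted f a h) (Set.Ioi 0) := by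
  refine (integrableOn_one_add_sq_mul_exp ha (C * B)).mono' (aestronglyMeasurable_weighted hf hm) ?_
  filter_upwards [ae_restrict_mem measurableSet_Ioi] with x hx
  exact norm_weighted_le hB hx (hh x hx)

theorem tendsto_integral_weighted (ha : 0 < a) (hf : ContinuousOn f (Set.Ici 0))
    (hB : ∀ x ∈ Set.Ici (0 : ℝ), |f x| ≤ B) {h : ℕ → ℝ → ℝ} {g : ℝ → ℝ}
    (hm : ∀ m, AEStronglyMeasurable (h m) (volume.restrict (Set.Ioi 0))) {C : ℝ}
    (hh : ∀ m x, 0 < m → 0 < x → |h m x| ≤ C * (1 + x ^ 2))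
    (hlim : ∀ x, 0 < x → Tendsto (fun m => h m x) atTop (𝓝 (g x))) :
    Tendsto (fun m => ∫ x in Set.Ioi 0, weighted f a (h m) x) atTop
      (𝓝 (∫ x in Set.Ioi 0, weighted f a g x)) := by
  refine tendsto_integral_filter_of_dominated_convergence _
    (Eventually.of_forall fun m => aestronglyMeasurable_weighted hf (hm m)) ?_
    (integrableOn_one_add_sq_mul_exp ha (C * B)) ?_
  -- The growth bound is available only for `m > 0`, hence the version of dominated convergence with
  -- eventual bounds.
  · filter_upwards [eventually_gt_atTop 0] with m hm0
    filter_upwards [ae_restrict_mem measurableSet_Ioi] with x hx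
    exact norm_weighted_le hB hx (hh m x hm0 hx)
  · filter_upwards [ae_restrict_mem measurableSet_Ioi] with x hx
    exact (hlim x hx).mul_const _

end Weight

/-! ### Exact formula for the MISE. -/

section Risk

variable {Ω : Type*} [MeasurableSpace Ω] {P : Measure Ω} [IsProbabilityMeasure P]
  {X : ℕ → Ω → ℝ} {ν : Measure ℝ} {f : ℝ → ℝ} {a B : ℝ}

theorem abs_estimator_sub_sq_le (d : ℕ → ℝ) (m n : ℕ) {x : ℝ} (hx : 0 < x) :
    |(estimator d m n x - cdf ν x) ^ 2| ≤ 4 * (1 + x ^ 2) := by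
  have h1 : |estimator d m n x| ≤ 1 :=
    abs_operator_le_one (fun _ => abs_empiricalCdf_le_one _ _ _) m hx.le
  have h2 := abs_cdf_le_one ν x
  have h3 := abs_sub (estimator d m n x) (cdf ν x)
  rw [abs_of_nonneg (sq_nonneg _), ← sq_abs]
  nlinarith [abs_nonneg (estimator d m n x - cdf ν x), sq_nonneg x]

theorem integrableOn_weightedSqError (ha : 0 < a) (hf : ContinuousOn f (Set.Ici 0))
    (hB : ∀ x ∈ Set.Ici (0 : ℝ), |f x| ≤ B) (d : ℕ → ℝ) (m n : ℕ) :
    IntegrableOn (weightedSqError (cdf ν) f a d m n) (Set.Ioi 0) := by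
  refine integrableOn_weighted (h := fun x => (estimator d m n x - cdf ν x) ^ 2) (C := 4) ha hf hB
    (Measurable.aestronglyMeasurable ?_) fun x hx => abs_estimator_sub_sq_le d m n hx
  exact ((measurable_operator m (u := fun _ => empiricalCdf d n) (fun _ => measurable_const)
    measurable_id fun _ _ => abs_empiricalCdf_le_one _ _ _).sub
      (monotone_cdf ν).measurable).pow_const 2

theorem integrable_weightedSqError_prod (hX : ∀ i, Measurable (X i)) (ha : 0 < a)
    (hf : ContinuousOn f (Set.Ici 0)) (hB : ∀ x ∈ Set.Ici (0 : ℝ), |f x| ≤ B) (m n : ℕ) :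
    Integrable (Function.uncurry fun ω x => weightedSqError (cdf ν) f a (fun i => X i ω) m n x)
      (P.prod (volume.restrict (Set.Ioi 0))) := by
  have hd : Integrable (fun z : Ω × ℝ => 1 * (4 * B * (1 + z.2 ^ 2) * Real.exp (-(a * z.2))))
      (P.prod (volume.restrict (Set.Ioi 0))) :=
    (integrable_const (1 : ℝ)).mul_prod (integrableOn_one_add_sq_mul_exp ha (4 * B))
  refine hd.mono' ?_ ?_
  · have h1 : Measurable fun z : Ω × ℝ => (estimator (fun i => X i z.1) m n z.2 - cdf ν z.2) ^ 2 :=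
      ((measurable_estimator hX m n).sub
        ((monotone_cdf ν).measurable.comp measurable_snd)).pow_const 2
    have h2 : AEStronglyMeasurable (fun x : ℝ => Real.exp (-(a * x)) * f x)
        (volume.restrict (Set.Ioi 0)) := by
      have h := aestronglyMeasurable_weighted (a := a) hf (h := fun _ => 1)
        aestronglyMeasurable_const
      unfold weighted at h
      simpa only [one_mul] using h
    exact h1.aestronglyMeasurable.mul h2.comp_snd
  · have hae : ∀ᵐ z ∂P.prod (volume.restrict (Set.Ioi (0 : ℝ))), z.2 ∈ Set.Ioi (0 : ℝ) :=
      Measure.quasiMeasurePreserving_snd.ae (ae_restrict_mem measurableSet_Ioi)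
    filter_upwards [hae] with z hz
    rw [one_mul]
    exact norm_weighted_le (h := fun x => (estimator (fun i => X i z.1) m n x - cdf ν x) ^ 2) hB hz
      (abs_estimator_sub_sq_le _ m n hz)

theorem mise_eq_integral [IsProbabilityMeasure ν] (hX : ∀ i, Measurable (X i)) (hlaw : ∀ i, P.map
    (X i) = ν)
    (hindep : iIndepFun X P) (ha : 0 < a) (hf : ContinuousOn f (Set.Ici 0))
    (hB : ∀ x ∈ Set.Ici (0 : ℝ), |f x| ≤ B) (m : ℕ) {n : ℕ} (hn : 0 < n) :
    mise P X (cdf ν) f a m n = ∫ x in Set.Ioi 0, weighted f a (fun x =>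
      (n : ℝ)⁻¹ * (secondMoment m (cdf ν) x - operator m (cdf ν) x ^ 2) +
        (operator m (cdf ν) x - cdf ν x) ^ 2) x := by
  unfold mise ise
  rw [integral_integral_swap (integrable_weightedSqError_prod hX ha hf hB m n)]
  refine setIntegral_congr_fun measurableSet_Ioi fun x hx => ?_
  have hx0 : 0 ≤ x := (Set.mem_Ioi.1 hx).le
  simp only [weightedSqError, weighted, estimator_eq_sum_kernelCdf _ m n hx0]
  rw [integral_mul_const, integral_sq_mean_sub_const P ν hX hlaw hindep (measurable_kernelCdf m x)
    (abs_kernelCdf_le_one m hx0) _ hn, integral_kernelCdf ν m hx0, integral_kernelCdf_sq ν m hx0]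

end Risk

end Szasz

/-! ### The expansion. -/

theorem mainTheorem3 {Ω : Type*} [MeasurableSpace Ω] (P : Measure Ω) [IsProbabilityMeasure P]
    (X : ℕ → Ω → ℝ) (ν : Measure ℝ) [IsProbabilityMeasure ν]
    -- `X 0, X 1, …` are i.i.d. random variables with law `ν`
    (hX : ∀ i, Measurable (X i)) (hlaw : ∀ i, P.map (X i) = ν) (hindep : iIndepFun X P)
    -- `ν` is carried by `[0, ∞)`
    (hsupp : ν (Set.Iio 0) = 0)
    -- the distribution function of `ν` is continuous, and it has continuous bounded first and
    -- second derivatives `f`, `f'` on `[0, ∞)` (one-sided at `0`)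
    (hF : Continuous (cdf ν))
    (f f' : ℝ → ℝ)
    (hf : ∀ x ∈ Set.Ici (0 : ℝ), HasDerivWithinAt (cdf ν) (f x) (Set.Ici 0) x)
    (hf' : ∀ x ∈ Set.Ici (0 : ℝ), HasDerivWithinAt f (f' x) (Set.Ici 0) x)
    (hf_cont : ContinuousOn f (Set.Ici 0)) (hf'_cont : ContinuousOn f' (Set.Ici 0))
    (hf_bdd : ∃ B : ℝ, ∀ x ∈ Set.Ici (0 : ℝ), |f x| ≤ B)
    (hf'_bdd : ∃ B : ℝ, ∀ x ∈ Set.Ici (0 : ℝ), |f' x| ≤ B)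
    (a : ℝ) (ha : 0 < a) :
    -- the integrals that define `C₁`, `C₂`, `C₃` and the MISE exist
    IntegrableOn (Szasz.weighted f a (Szasz.sigmaSq (cdf ν))) (Set.Ioi 0) ∧
    IntegrableOn (Szasz.weighted f a (Szasz.varTerm f)) (Set.Ioi 0) ∧
    IntegrableOn (Szasz.weighted f a (fun y => Szasz.biasTerm f' y ^ 2)) (Set.Ioi 0) ∧
    (∀ m n : ℕ, 0 < m → 0 < n →
      (∀ ω, IntegrableOn (Szasz.weightedSqError (cdf ν) f a (fun i => X i ω) m n) (Set.Ioi 0)) ∧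
      Integrable (fun ω => Szasz.ise (cdf ν) f a (fun i => X i ω) m n) P) ∧
    -- the expansion of the MISE as `m, n → ∞`
    ∃ r₁ r₂ : ℕ × ℕ → ℝ,
      r₁ =o[atTop ×ˢ atTop] (fun p : ℕ × ℕ => (p.1 : ℝ) ^ (-(1 / 2) : ℝ) * (p.2 : ℝ)⁻¹) ∧
      r₂ =o[atTop ×ˢ atTop] (fun p : ℕ × ℕ => ((p.1 : ℝ) ^ 2)⁻¹) ∧
      ∀ m n : ℕ, 0 < m → 0 < n →
        Szasz.mise P X (cdf ν) f a m n =
          (n : ℝ)⁻¹ * Szasz.C₁ (cdf ν) f a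
            - (m : ℝ) ^ (-(1 / 2) : ℝ) * (n : ℝ)⁻¹ * Szasz.C₂ f a
            + ((m : ℝ) ^ 2)⁻¹ * Szasz.C₃ f f' a
            + r₁ (m, n) + r₂ (m, n) := by
  obtain ⟨B₁, hB₁⟩ := hf_bdd
  obtain ⟨B, hB⟩ := hf'_bdd
  have hB0 : 0 ≤ B := (abs_nonneg _).trans (hB 0 Set.self_mem_Ici)
  have hB10 : 0 ≤ B₁ := (abs_nonneg _).trans (hB₁ 0 Set.self_mem_Ici)
  have hF1 := Szasz.abs_cdf_le_one ν
  have hFm : Measurable (cdf ν) := hF.measurable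
  have mf : AEStronglyMeasurable f (volume.restrict (Set.Ioi 0)) :=
    (hf_cont.mono Set.Ioi_subset_Ici_self).aestronglyMeasurable measurableSet_Ioi
  have mf' : AEStronglyMeasurable f' (volume.restrict (Set.Ioi 0)) :=
    (hf'_cont.mono Set.Ioi_subset_Ici_self).aestronglyMeasurable measurableSet_Ioi
  have mS : ∀ m, Measurable fun x => Szasz.operator m (cdf ν) x := fun m =>
    Szasz.measurable_operator m (u := fun _ => cdf ν) (fun _ => measurable_const) measurable_id
      fun _ => hF1
  have mσ : Measurable (Szasz.sigmaSq (cdf ν)) := hFm.mul (hFm.const_sub 1)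
  have mD : ∀ m, AEStronglyMeasurable (Szasz.scaledVarDiff m (cdf ν))
      (volume.restrict (Set.Ioi 0)) := fun m =>
    (((Szasz.aestronglyMeasurable_secondMoment hF1 m).sub
      ((mS m).pow_const 2).aestronglyMeasurable).sub mσ.aestronglyMeasurable).const_mul _
  have mE : ∀ m : ℕ, AEStronglyMeasurable (fun x => ((m : ℝ) * (Szasz.operator m (cdf ν) x -
      cdf ν x)) ^ 2) (volume.restrict (Set.Ioi 0)) := fun m =>
    ((((mS m).sub hFm).const_mul _).pow_const 2).aestronglyMeasurable
  have bσ : ∀ x, 0 < x → |Szasz.sigmaSq (cdf ν) x| ≤ 1 * (1 + x ^ 2) := fun x _ => by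
    have h0 := cdf_nonneg ν x
    have h1 := cdf_le_one ν x
    rw [Szasz.sigmaSq, abs_of_nonneg (mul_nonneg h0 (by linarith))]
    nlinarith [sq_nonneg x]
  have bD : ∀ m x, 0 < m → 0 < x →
      |Szasz.scaledVarDiff m (cdf ν) x| ≤ (2 * B₁ + 4 * B) * (1 + x ^ 2) := fun m x hm hx => by
    refine (Szasz.abs_scaledVarDiff_le hf hf' hB hB₁ hF1 hm hx.le).trans ?_
    nlinarith [mul_nonneg hB10 (sq_nonneg (x - 1)), mul_nonneg hB0 (sq_nonneg (x - 1)),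
      mul_nonneg hB10 (sq_nonneg x), mul_nonneg hB0 (sq_nonneg x)]
  have bE : ∀ (m : ℕ) x, 0 < m → 0 < x →
      |((m : ℝ) * (Szasz.operator m (cdf ν) x - cdf ν x)) ^ 2| ≤ B ^ 2 * (1 + x ^ 2) :=
    fun m x hm hx => by
    have hm' : (0 : ℝ) < m := by positivity
    have h := Szasz.abs_operator_sub_le hf hf' hB hF1 hm hx.le
    have h2 : |(m : ℝ) * (Szasz.operator m (cdf ν) x - cdf ν x)| ≤ B * x := by
      rw [abs_mul, abs_of_pos hm', mul_comm]
      rwa [le_div_iff₀ hm'] at h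
    rw [abs_pow]
    refine (pow_le_pow_left₀ (abs_nonneg _) h2 2).trans ?_
    nlinarith [sq_nonneg B]
  have iσ := Szasz.integrableOn_weighted ha hf_cont hB₁ mσ.aestronglyMeasurable bσ
  have iD := fun m hm => Szasz.integrableOn_weighted ha hf_cont hB₁ (mD m) fun x => bD m x hm
  have iE := fun m hm => Szasz.integrableOn_weighted ha hf_cont hB₁ (mE m) fun x => bE m x hm
  have iV : IntegrableOn (Szasz.weighted f a (Szasz.varTerm f)) (Set.Ioi 0) := by
    refine Szasz.integrableOn_weighted (C := B₁) ha hf_cont hB₁ (mf.mul (by fun_prop))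
      fun x hx => ?_
    rw [Szasz.varTerm, abs_mul, abs_of_nonneg (Real.sqrt_nonneg _)]
    refine mul_le_mul (hB₁ x hx.le) ?_ (Real.sqrt_nonneg _) hB10
    rw [Real.sqrt_le_left (by positivity), div_le_iff₀ Real.pi_pos]
    nlinarith [Real.pi_gt_three, sq_nonneg x, sq_nonneg (x - 1), sq_nonneg (x ^ 2)]
  have ib : IntegrableOn (Szasz.weighted f a (fun y => Szasz.biasTerm f' y ^ 2)) (Set.Ioi 0) := by
    refine Szasz.integrableOn_weighted (C := B ^ 2) ha hf_cont hB₁ ?_ fun x hx => ?_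
    · exact ((measurable_id.aestronglyMeasurable.mul mf').mul_const (2⁻¹ : ℝ)).pow 2
    · have h : |Szasz.biasTerm f' x| ≤ x * B := by
        rw [Szasz.biasTerm, abs_div, abs_mul, abs_two, abs_of_pos hx]
        nlinarith [mul_le_mul_of_nonneg_left (hB x hx.le) hx.le, mul_nonneg hx.le hB0]
      rw [abs_pow]
      refine (pow_le_pow_left₀ (abs_nonneg _) h 2).trans ?_
      nlinarith [sq_nonneg B]
  have tD := Szasz.tendsto_integral_weighted (g := fun x => -Szasz.varTerm f x) ha hf_cont hB₁ mD bD
    fun x hx => Szasz.tendsto_scaledVarDiff hf hf' hB hF1 hx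
  have tE := Szasz.tendsto_integral_weighted (g := fun x => Szasz.biasTerm f' x ^ 2) ha hf_cont hB₁
    mE bE fun x hx => (Szasz.tendsto_mul_operator_sub hf hf' hB hF1 hx.le).pow 2
  have eD : ∫ x in Set.Ioi 0, Szasz.weighted f a (fun x => -Szasz.varTerm f x) x =
      -Szasz.C₂ f a := by
    rw [Szasz.C₂, ← integral_neg]
    simp only [Szasz.weighted, neg_mul]
  rw [eD] at tD
  refine ⟨iσ, iV, ib, fun m n _ _ => ⟨fun ω =>
    Szasz.integrableOn_weightedSqError ha hf_cont hB₁ _ m n,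
    (Szasz.integrable_weightedSqError_prod hX ha hf_cont hB₁ m n).integral_prod_left⟩,
    -- Each remainder is its rate times the difference between a rescaled integral and its limit, so
    -- the expansion is an exact identity for all positive `m`, `n`.
    fun p => (p.1 : ℝ) ^ (-(1 / 2) : ℝ) * (p.2 : ℝ)⁻¹ *
      ((∫ x in Set.Ioi 0, Szasz.weighted f a (Szasz.scaledVarDiff p.1 (cdf ν)) x) + Szasz.C₂ f a),
    fun p => ((p.1 : ℝ) ^ 2)⁻¹ * ((∫ x in Set.Ioi 0, Szasz.weighted f a (fun x =>
      ((p.1 : ℝ) * (Szasz.operator p.1 (cdf ν) x - cdf ν x)) ^ 2) x) - Szasz.C₃ f f' a),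
    ?_, ?_, fun m n hm hn => ?_⟩
  · have h : Tendsto (fun p : ℕ × ℕ =>
        (∫ x in Set.Ioi 0, Szasz.weighted f a (Szasz.scaledVarDiff p.1 (cdf ν)) x) + Szasz.C₂ f a)
        (atTop ×ˢ atTop) (𝓝 0) := by
      have h0 := (tD.add_const (Szasz.C₂ f a)).comp
        (tendsto_fst (f := atTop) (g := atTop (α := ℕ)))
      rwa [neg_add_cancel] at h0
    simpa using (isBigO_refl _ _).mul_isLittleO ((isLittleO_one_iff ℝ).2 h)
  · have h : Tendsto (fun p : ℕ × ℕ => (∫ x in Set.Ioi 0, Szasz.weighted f a (fun x =>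
        ((p.1 : ℝ) * (Szasz.operator p.1 (cdf ν) x - cdf ν x)) ^ 2) x) - Szasz.C₃ f f' a)
        (atTop ×ˢ atTop) (𝓝 0) := by
      have h0 := (tE.sub_const (Szasz.C₃ f f' a)).comp
        (tendsto_fst (f := atTop) (g := atTop (α := ℕ)))
      rwa [← Szasz.C₃, sub_self] at h0
    simpa using (isBigO_refl _ _).mul_isLittleO ((isLittleO_one_iff ℝ).2 h)
  · have hm' : (0 : ℝ) < m := by positivity
    have hs : 0 < √(m : ℝ) := Real.sqrt_pos.2 hm'
    have hr : (m : ℝ) ^ (-(1 / 2) : ℝ) = (√m)⁻¹ := by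
      rw [Real.rpow_neg hm'.le, ← Real.sqrt_eq_rpow]
    -- Splits the variance as `σ²` plus `m^{-1/2}` times the scaled difference, and the squared bias
    -- as `m⁻²` times the square of the scaled bias.
    have e : ∀ x, Szasz.weighted f a (fun x => (n : ℝ)⁻¹ * (Szasz.secondMoment m (cdf ν) x -
        Szasz.operator m (cdf ν) x ^ 2) + (Szasz.operator m (cdf ν) x - cdf ν x) ^ 2) x =
        (n : ℝ)⁻¹ * Szasz.weighted f a (Szasz.sigmaSq (cdf ν)) x +
          (√m)⁻¹ * (n : ℝ)⁻¹ * Szasz.weighted f a (Szasz.scaledVarDiff m (cdf ν)) x +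
          ((m : ℝ) ^ 2)⁻¹ * Szasz.weighted f a (fun x =>
            ((m : ℝ) * (Szasz.operator m (cdf ν) x - cdf ν x)) ^ 2) x := fun x => by
      simp only [Szasz.weighted, Szasz.scaledVarDiff]
      field_simp
      ring
    rw [Szasz.mise_eq_integral hX hlaw hindep ha hf_cont hB₁ m hn]
    simp only [e, hr]
    rw [integral_add (Szasz.integrable_fun_add (iσ.const_mul _) ((iD m hm).const_mul _))
      ((iE m hm).const_mul _), integral_add (iσ.const_mul _) ((iD m hm).const_mul _),
      integral_const_mul, integral_const_mul, integral_const_mul, ← Szasz.C₁]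
    ring
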